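/- Let $\Gamma \subset \mathrm{GL}_n(\mathbb{C})$ be a finite matrix group acting on $\mathbb{C}[\mathbf{t}]=\mathbb{C}[t_0,\dots,t_{n-1}]$ by $f(\mathbf{t}) \mapsto f(\sigma \mathbf{t})$, where $\mathbf{t}$ is the column vector of the variables. For $k \ge 0$ the E-polynomial of weight $k$ for $\Gamma$ is $$\varphi_k^{\Gamma} = \frac{1}{|\Gamma|}\sum_{\sigma\in\Gamma} (\sigma_0\mathbf{t})^k ,$$ where $\sigma_0$ denotes the first row of $\sigma$. Let $\mathfrak{E}(\Gamma)$ be the $\mathbb{C}$-algebra generated by all $\varphi_k^{\Gamma}$, let $\mathfrak{R}(\Gamma)=\mathbb{C}[\mathbf{t}]^{\Gamma}$ be the invariant ring, and let $A_k$ denote the space of homogeneous elements of degree $k$ (together with $0$) of a subalgebra $A \subseteq \mathbb{C}[\mathbf{t}]$. We say that $\mathfrak{E}(\Gamma)$ is minimally generated by $\varphi_k^{\Gamma}$, $k\in W$, if these generate it as a $\mathbb{C}$-algebra and no proper subfamily of them does. Let $\zeta = e^{2\pi i/5}$ and $$G=\left\langle \frac{1}{i\sqrt{3}}\begin{pmatrix}1&2\\1&-1\end{pmatrix},\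 \begin{pmatrix}1&0\\0&e^{2\pi i/3}\end{pmatrix}\right\rangle \subset \mathrm{GL}_2(\mathbb{C}),$$ $$H=\left\langle \frac{1}{\sqrt5}\begin{pmatrix}1&2&2\\1&\zeta+\zeta^4&\zeta^2+\zeta^3\\1&\zeta^2+\zeta^3&\zeta+\zeta^4\end{pmatrix},\ \begin{pmatrix}1&0&0\\0&\zeta^2&0\\0&0&\zeta^3\end{pmatrix},\ -\begin{pmatrix}1&0&0\\0&0&1\\0&1&0\end{pmatrix}\right\rangle \subset \mathrm{GL}_3(\mathbb{C}).$$ (1) The group $G$ has order $24$. The ring $\mathfrak{E}(G)$ is minimally generated by $\varphi_4^G$ and $\varphi_6^G$. For all even $k\ge 4$, $\mathfrak{E}(G)_k=\mathfrak{R}(G)_k$; in particular $\dim\mathfrak{E}(G)_k=\dim\mathfrak{R}(G)_k$. Moreover $$\sum_{k\ge0}\dim(\mathfrak{E}(G)_k)\,t^k=\frac{1}{(1-t^4)(1-t^6)} .$$ (2) The group $H$ has order $120$. The ring $\mathfrak{E}(H)$ is minimally generated by $\varphi_2^H$, $\varphi_6^H$ and $\varphi_{10}^H$. For all even $k\ge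 0$, $\mathfrak{E}(H)_k=\mathfrak{R}(H)_k$; in particular $\dim\mathfrak{E}(H)_k=\dim\mathfrak{R}(H)_k$. Moreover $$\sum_{k\ge0}\dim(\mathfrak{E}(H)_k)\,t^k=\frac{1}{(1-t^2)(1-t^6)(1-t^{10})} .$$ -/

import Mathlib

namespace EPoly

noncomputable section

/-- The linear form `(A t)_i = ∑ j, A i j * t_j` in the variables `t_0, …, t_{n-1}`. -/
def linForm {n : ℕ} (A : Matrix (Fin n) (Fin n) ℂ) (i : Fin n) : MvPolynomial (Fin n) ℂ :=
  ∑ j, MvPolynomial.C (A i j) * MvPolynomial.X j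

/-- The substitution `f(t) ↦ f(A t)`. -/
def subst {n : ℕ} (A : Matrix (Fin n) (Fin n) ℂ) :
    MvPolynomial (Fin n) ℂ →ₐ[ℂ] MvPolynomial (Fin n) ℂ :=
  MvPolynomial.aeval (linForm A)

/-- The E-polynomial `φ_k = (1/|G|) ∑_{σ ∈ G} (σ_0 t)^k` of a (finite) matrix group `G`,
where `σ_0` is the first row of `σ`. -/
def ePoly {n : ℕ} [NeZero n] (G : Subgroup (Matrix.GeneralLinearGroup (Fin n) ℂ)) (k : ℕ) :
    MvPolynomial (Fin n) ℂ :=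
  MvPolynomial.C ((Nat.card G : ℂ)⁻¹) *
    ∑ᶠ σ : G, linForm (σ : Matrix.GeneralLinearGroup (Fin n) ℂ).val 0 ^ k

/-- The ring generated over `ℂ` by all E-polynomials of `G`. -/
def eRing {n : ℕ} [NeZero n] (G : Subgroup (Matrix.GeneralLinearGroup (Fin n) ℂ)) :
    Subalgebra ℂ (MvPolynomial (Fin n) ℂ) :=
  Algebra.adjoin ℂ (Set.range (ePoly G))

/-- The invariant ring `ℂ[t_0, …, t_{n-1}]^G`. -/
def invRing {n : ℕ} (G : Subgroup (Matrix.GeneralLinearGroup (Fin n) ℂ)) :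
    Subalgebra ℂ (MvPolynomial (Fin n) ℂ) where
  carrier := {f | ∀ σ ∈ G, subst σ.val f = f}
  mul_mem' := fun ha hb σ hσ => by rw [map_mul, ha σ hσ, hb σ hσ]
  add_mem' := fun ha hb σ hσ => by rw [map_add, ha σ hσ, hb σ hσ]
  algebraMap_mem' := fun r σ _ => AlgHom.commutes (subst σ.val) r

/-- The space of elements of `A` that are homogeneous of degree `k` (zero included). -/
def degPart {n : ℕ} (A : Subalgebra ℂ (MvPolynomial (Fin n) ℂ)) (k : ℕ) :
    Submodule ℂ (MvPolynomial (Fin n) ℂ) :=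
  Subalgebra.toSubmodule A ⊓ MvPolynomial.homogeneousSubmodule (Fin n) ℂ k

/-- The dimension formula (Hilbert series) `∑_k (dim A_k) t^k`. -/
def hilbertSeries {n : ℕ} (A : Subalgebra ℂ (MvPolynomial (Fin n) ℂ)) : PowerSeries ℚ :=
  PowerSeries.mk fun k => (Module.finrank ℂ (degPart A k) : ℚ)

/-- The ring of E-polynomials of `G` is generated by the `φ_k` with `k ∈ W`, and by no
`φ_k` with `k` in a proper subset of `W`. -/
def MinimallyGeneratedByWeights {n : ℕ} [NeZero n]
    (G : Subgroup (Matrix.GeneralLinearGroup (Fin n) ℂ)) (W : Set ℕ) : Prop :=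
  Algebra.adjoin ℂ (ePoly G '' W) = eRing G ∧
    ∀ W' : Set ℕ, W' ⊂ W → Algebra.adjoin ℂ (ePoly G '' W') ≠ eRing G

/-! ### The group attached to ternary self-dual codes -/

/-- `e^{2πi/3}` -/
def omega : ℂ := Complex.exp (2 * Real.pi * Complex.I / 3)

/-- The matrix `(1/(i√3)) (1, 2; 1, -1)`. -/
def ternaryM : Matrix (Fin 2) (Fin 2) ℂ :=
  (1 / (Complex.I * (Real.sqrt 3 : ℂ))) • !![1, 2; 1, -1]

theorem omega_pow : omega ^ 3 = 1 := by
  rw [omega, ← Complex.exp_nat_mul]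
  convert Complex.exp_two_pi_mul_I using 2
  push_cast
  ring

theorem ternaryM_mul_self : ternaryM * ternaryM = -1 := by
  have h3 : (Real.sqrt 3 : ℂ) * (Real.sqrt 3 : ℂ) = 3 := by
    rw [← Complex.ofReal_mul, Real.mul_self_sqrt (by norm_num)]
    norm_num
  have hs : (1 / (Complex.I * (Real.sqrt 3 : ℂ))) * (1 / (Complex.I * (Real.sqrt 3 : ℂ)))
      = -(1 / 3) := by
    rw [div_mul_div_comm, mul_mul_mul_comm, Complex.I_mul_I, h3]
    norm_num
  rw [ternaryM, Matrix.smul_mul, Matrix.mul_smul, smul_smul, hs]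
  ext i j
  fin_cases i <;> fin_cases j <;>
    norm_num [Matrix.mul_apply, Fin.sum_univ_two]

/-- `ternaryM` as an invertible matrix. -/
def ternaryA : Matrix.GeneralLinearGroup (Fin 2) ℂ where
  val := ternaryM
  inv := -ternaryM
  val_inv := by rw [mul_neg, ternaryM_mul_self, neg_neg]
  inv_val := by rw [neg_mul, ternaryM_mul_self, neg_neg]

/-- The matrix `diag(1, e^{2πi/3})`. -/
def ternaryB : Matrix.GeneralLinearGroup (Fin 2) ℂ where
  val := !![1, 0; 0, omega]
  inv := !![1, 0; 0, omega ^ 2]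
  val_inv := by
    ext i j
    have h := omega_pow
    fin_cases i <;> fin_cases j <;> simp [Matrix.mul_apply, Fin.sum_univ_two]
    linear_combination h
  inv_val := by
    ext i j
    have h := omega_pow
    fin_cases i <;> fin_cases j <;> simp [Matrix.mul_apply, Fin.sum_univ_two]
    linear_combination h

/-- The group attached to ternary self-dual codes. -/
def ternaryGroup : Subgroup (Matrix.GeneralLinearGroup (Fin 2) ℂ) :=
  Subgroup.closure {ternaryA, ternaryB}

/-! ### The group attached to symmetric Hilbert modular forms -/

/-- `ζ = e^{2πi/5}` -/
def zeta : ℂ := Complex.exp (2 * Real.pi * Complex.I / 5)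

/-- The matrix `(1/√5) (1, 2, 2; 1, ζ + ζ⁴, ζ² + ζ³; 1, ζ² + ζ³, ζ + ζ⁴)`. -/
def hilbertM : Matrix (Fin 3) (Fin 3) ℂ :=
  (1 / (Real.sqrt 5 : ℂ)) •
    !![1, 2, 2;
       1, zeta + zeta ^ 4, zeta ^ 2 + zeta ^ 3;
       1, zeta ^ 2 + zeta ^ 3, zeta + zeta ^ 4]

theorem zeta_pow : zeta ^ 5 = 1 := by
  rw [zeta, ← Complex.exp_nat_mul]
  convert Complex.exp_two_pi_mul_I using 2
  push_cast
  ring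

theorem zeta_sum : 1 + zeta + zeta ^ 2 + zeta ^ 3 + zeta ^ 4 = 0 := by
  have h : IsPrimitiveRoot zeta 5 := Complex.isPrimitiveRoot_exp 5 (by norm_num)
  have := h.geom_sum_eq_zero (by norm_num)
  simpa [Finset.sum_range_succ] using this

theorem hilbertM_mul_self : hilbertM * hilbertM = 1 := by
  have h5 : (Real.sqrt 5 : ℂ) * (Real.sqrt 5 : ℂ) = 5 := by
    rw [← Complex.ofReal_mul, Real.mul_self_sqrt (by norm_num)]
    norm_num
  have hs : (1 / (Real.sqrt 5 : ℂ)) * (1 / (Real.sqrt 5 : ℂ)) = 1 / 5 := by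
    rw [div_mul_div_comm, h5]
    norm_num
  have hsum := zeta_sum
  have hp := zeta_pow
  set a := zeta + zeta ^ 4 with ha
  set b := zeta ^ 2 + zeta ^ 3 with hb
  have hab : a + b = -1 := by rw [ha, hb]; linear_combination hsum
  have hmul : a * b = -1 := by
    rw [ha, hb]
    linear_combination (zeta + zeta ^ 2) * hp + hsum
  have hsq : a * a + b * b = 3 := by linear_combination (a + b - 1) * hab - 2 * hmul
  rw [hilbertM, Matrix.smul_mul, Matrix.mul_smul, smul_smul, hs, ← ha, ← hb]
  ext i j
  fin_cases i <;> fin_cases j <;> simp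
  · norm_num
  · linear_combination 2 * hab
  · linear_combination 2 * hab
  · linear_combination hab
  · linear_combination (1 / 5) * hsq
  · linear_combination 2 * hmul
  · linear_combination hab
  · linear_combination 2 * hmul
  · linear_combination (1 / 5) * hsq

/-- `hilbertM` as an invertible matrix. -/
def hilbertA : Matrix.GeneralLinearGroup (Fin 3) ℂ where
  val := hilbertM
  inv := hilbertM
  val_inv := hilbertM_mul_self
  inv_val := hilbertM_mul_self

/-- The matrix `diag(1, ζ², ζ³)`. -/
def hilbertB : Matrix.GeneralLinearGroup (Fin 3) ℂ where
  val := !![1, 0, 0; 0, zeta ^ 2, 0; 0, 0, zeta ^ 3]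
  inv := !![1, 0, 0; 0, zeta ^ 3, 0; 0, 0, zeta ^ 2]
  val_inv := by
    ext i j
    have h := zeta_pow
    fin_cases i <;> fin_cases j <;> simp [Matrix.mul_apply, Fin.sum_univ_three]
    · linear_combination h
    · linear_combination h
  inv_val := by
    ext i j
    have h := zeta_pow
    fin_cases i <;> fin_cases j <;> simp [Matrix.mul_apply, Fin.sum_univ_three]
    · linear_combination h
    · linear_combination h

/-- Minus the permutation matrix that exchanges the last two coordinates. -/
def hilbertC : Matrix.GeneralLinearGroup (Fin 3) ℂ where
  val := -!![1, 0, 0; 0, 0, 1; 0, 1, 0]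
  inv := -!![1, 0, 0; 0, 0, 1; 0, 1, 0]
  val_inv := by
    ext i j
    fin_cases i <;> fin_cases j <;> simp [Matrix.mul_apply, Fin.sum_univ_three]
  inv_val := by
    ext i j
    fin_cases i <;> fin_cases j <;> simp [Matrix.mul_apply, Fin.sum_univ_three]

/-- The group attached to symmetric Hilbert modular forms. -/
def hilbertGroup : Subgroup (Matrix.GeneralLinearGroup (Fin 3) ℂ) :=
  Subgroup.closure {hilbertA, hilbertB, hilbertC}

end

end EPoly

namespace EPoly

noncomputable section

open MvPolynomial

/-! ### The Jacobian determinant -/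

/-! Both rings coincide with the full invariant ring, and both invariant rings are polynomial rings;
the argument is a Jacobian criterion for reflection groups. Let `f` consist of the E-polynomials of
the chosen weights `w i`, with Jacobian `J ≠ 0`. The Jacobian of any family of invariants is
multiplied by `det⁻¹` under the group (`jacobian_subst`), so a reflection whose nontrivial
eigenvalue has order greater than `e` forces the `e`-th power of its mirror form to divide that
Jacobian (`vecForm_pow_dvd`). The mirrors are pairwise non-proportional, so the product `D` of these
powers divides every such Jacobian. The degrees agree: `3 + 5 = 4 * 2` for the ternary group and `1
+ 5 + 9 = 15 * 1` for the Hilbert modular group. Hence `J` is a nonzero constant times `D`, and `J`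
divides all Jacobians of invariants (`jacobian_dvd_jacobian`).

For a homogeneous invariant `p` of degree `k > 0`, Cramer's rule writes the gradient of `p` in terms
of the gradients of the `f i`. The coefficients `g i` are quotients of Jacobians, hence invariant
polynomials. Euler's identity turns this into `k * p = ∑ w i * f i * g i`, and induction on the
degree puts `p` in the algebra generated by the `f i` (`degPart_invRing_eq_map`).

Since `J ≠ 0`, the `f i` are algebraically independent, which yields both the Hilbert series and
minimality (`eRing_properties`). The group-specific work is a normal form for the elements, which
gives the order and the first rows, the value of `J` at one point, and a list of mirrors. -/

/-- The Jacobian determinant of a family of `n` polynomials in `n` variables. -/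
def jacobian {n : ℕ} (f : Fin n → MvPolynomial (Fin n) ℂ) : MvPolynomial (Fin n) ℂ :=
  (Matrix.of fun i j => pderiv j (f i)).det

theorem pderiv_aeval {n m : ℕ} (f : Fin m → MvPolynomial (Fin n) ℂ)
    (p : MvPolynomial (Fin m) ℂ) (j : Fin n) :
    pderiv j (aeval f p) = ∑ i, aeval f (pderiv i p) * pderiv j (f i) := by
  induction p using MvPolynomial.induction_on with
  | C a => simp
  | add p q hp hq => simp only [map_add, hp, hq, add_mul, Finset.sum_add_distrib]
  | mul_X p i hp =>
    simp only [map_mul, aeval_X, Derivation.leibniz, smul_eq_mul, hp, pderiv_X, map_add,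
      add_mul, Finset.sum_add_distrib, Finset.mul_sum]
    congr 1
    · rw [Finset.sum_eq_single i]
      · simp
      · intro b _ hb
        simp [hb.symm]
      · simp
    · exact Finset.sum_congr rfl fun _ _ => by ring

theorem pderiv_linForm {n : ℕ} (A : Matrix (Fin n) (Fin n) ℂ) (i j : Fin n) :
    pderiv j (linForm A i) = C (A i j) := by
  simp only [linForm, map_sum, pderiv_C_mul, pderiv_X]
  rw [Finset.sum_eq_single j]
  · simp
  · intro b _ hb
    simp [hb.symm]
  · simp

/-- The chain rule applied to `h(A t) = h(t)` factors the Jacobian matrix. The Jacobian is thus a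
semi-invariant, and a reflection acts on it by a nontrivial scalar. -/
theorem jacobian_subst {n : ℕ} (A : Matrix (Fin n) (Fin n) ℂ)
    (h : Fin n → MvPolynomial (Fin n) ℂ) (hh : ∀ i, subst A (h i) = h i) :
    jacobian h = subst A (jacobian h) * C A.det := by
  rw [jacobian, AlgHom.map_det, RingHom.map_det, ← Matrix.det_mul]
  congr 1
  ext1 i j
  rw [Matrix.of_apply]
  conv_lhs => rw [← hh i, subst, pderiv_aeval]
  simp [Matrix.mul_apply, pderiv_linForm, subst]

theorem totalDegree_pderiv_lt {n : ℕ} (p : MvPolynomial (Fin n) ℂ) (i : Fin n) {m : ℕ}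
    (hp : p.totalDegree ≤ m + 1) : (pderiv i p).totalDegree ≤ m := by
  refine Finset.sup_le fun d hd => ?_
  have hd' : d + Finsupp.single i 1 ∈ p.support := by
    rw [mem_support_iff, coeff_pderiv] at hd
    exact mem_support_iff.2 (left_ne_zero_of_mul hd)
  have := (le_totalDegree hd').trans hp
  rw [Finsupp.sum_add_index' (by simp) (by simp), Finsupp.sum_single_index rfl] at this
  omega

/-- Characteristic zero enters here: differentiation multiplies a coefficient by a positive
exponent, which is invertible. -/
theorem eq_C_of_pderiv_eq_zero {n : ℕ} (p : MvPolynomial (Fin n) ℂ)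
    (hp : ∀ i, pderiv i p = 0) : p = C (coeff 0 p) := by
  ext m
  rw [coeff_C]
  split_ifs with hm
  · rw [hm]
  · obtain ⟨i, hi⟩ : ∃ i, m i ≠ 0 := by
      by_contra! h
      exact hm (Finsupp.ext fun i => (h i).symm)
    have hle : Finsupp.single i 1 ≤ m := by
      rw [Finsupp.single_le_iff]; omega
    have h := congrArg (coeff (m - Finsupp.single i 1)) (hp i)
    rw [coeff_pderiv, tsub_add_cancel_of_le hle, coeff_zero] at h
    exact (mul_eq_zero.1 h).resolve_right (Nat.cast_add_one_ne_zero _)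

/-- Differentiating a relation `p` among the `f i` gives a vector of relations annihilated by the
Jacobian matrix. As `J ≠ 0` in a domain, every partial derivative of `p` is again a relation, of
smaller degree; by induction they vanish, so `p` is constant and therefore zero. -/
theorem algebraicIndependent_of_jacobian {n : ℕ} (f : Fin n → MvPolynomial (Fin n) ℂ)
    (hJ : jacobian f ≠ 0) : AlgebraicIndependent ℂ f := by
  rw [algebraicIndependent_iff]
  have hconst : ∀ p : MvPolynomial (Fin n) ℂ, aeval f p = 0 → (∀ i, pderiv i p = 0) → p = 0 := by
    intro p h0 hp
    rw [eq_C_of_pderiv_eq_zero p hp] at h0 ⊢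
    simpa using h0
  have hder : ∀ p : MvPolynomial (Fin n) ℂ, aeval f p = 0 → ∀ i, aeval f (pderiv i p) = 0 := by
    intro p hp
    refine congrFun (Matrix.eq_zero_of_vecMul_eq_zero hJ (funext fun j => ?_) :
      (fun i => aeval f (pderiv i p)) = 0)
    have := pderiv_aeval f p j
    rw [hp, map_zero] at this
    exact this.symm
  suffices ∀ m : ℕ, ∀ p : MvPolynomial (Fin n) ℂ, p.totalDegree ≤ m → aeval f p = 0 → p = 0 from
    fun p => this _ p le_rfl
  intro m
  induction m with
  | zero =>
    intro p hp h0
    rw [totalDegree_eq_zero_iff_eq_C.1 (Nat.le_zero.1 hp)] at h0 ⊢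
    simpa using h0
  | succ m ih =>
    exact fun p hp h0 =>
      hconst p h0 fun i => ih _ (totalDegree_pderiv_lt p i hp) (hder p h0 i)

theorem totalDegree_jacobian_le {n : ℕ} (f : Fin n → MvPolynomial (Fin n) ℂ) (w : Fin n → ℕ)
    (hf : ∀ i, (f i).IsHomogeneous (w i)) : (jacobian f).totalDegree ≤ ∑ i, (w i - 1) := by
  rw [jacobian, Matrix.det_apply]
  refine totalDegree_finsetSum_le fun σ _ => (totalDegree_smul_le _ _).trans ?_
  refine (totalDegree_finsetProd _ _).trans ?_
  rw [← Equiv.sum_comp σ fun i => w i - 1]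
  exact Finset.sum_le_sum fun i _ => (hf (σ i)).pderiv.totalDegree_le

/-- Cramer's rule for the gradient of a polynomial. -/
theorem sum_jacobian_update {n : ℕ} (f : Fin n → MvPolynomial (Fin n) ℂ)
    (p : MvPolynomial (Fin n) ℂ) (j : Fin n) :
    ∑ i, jacobian (Function.update f i p) * pderiv j (f i) = jacobian f * pderiv j p := by
  set M : Matrix (Fin n) (Fin n) (MvPolynomial (Fin n) ℂ) := Matrix.of fun i j => pderiv j (f i)
  have h := congrFun (Matrix.mulVec_cramer M.transpose fun j => pderiv j p) j
  rw [Matrix.det_transpose] at h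
  refine Eq.trans ?_ h
  rw [Matrix.mulVec, dotProduct]
  refine Finset.sum_congr rfl fun i _ => ?_
  rw [Matrix.cramer_transpose_apply, mul_comm, jacobian]
  congr 2
  ext1 a b
  by_cases hab : a = i
  · subst hab; simp
  · simp [hab, M]

/-! ### Invariant rings generated by polynomials with a minimal Jacobian -/

theorem isHomogeneous_linForm {n : ℕ} (A : Matrix (Fin n) (Fin n) ℂ) (i : Fin n) :
    (linForm A i).IsHomogeneous 1 :=
  IsHomogeneous.sum _ _ _ fun j _ => isHomogeneous_C_mul_X _ j

theorem subst_isHomogeneous {n : ℕ} (A : Matrix (Fin n) (Fin n) ℂ) {p : MvPolynomial (Fin n) ℂ}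
    {k : ℕ} (hp : p.IsHomogeneous k) : (subst A p).IsHomogeneous k := by
  have := hp.aeval _ (isHomogeneous_linForm A)
  rwa [one_mul] at this

theorem homogeneousComponent_mul_of_isHomogeneous {n : ℕ} {p : MvPolynomial (Fin n) ℂ} {d : ℕ}
    (hp : p.IsHomogeneous d) (q : MvPolynomial (Fin n) ℂ) (k : ℕ) :
    homogeneousComponent k (p * q) =
      if d ≤ k then p * homogeneousComponent (k - d) q else 0 := by
  conv_lhs => rw [← sum_homogeneousComponent q, Finset.mul_sum, map_sum]
  have h : ∀ i, homogeneousComponent k (p * homogeneousComponent i q) =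
      if k = d + i then p * homogeneousComponent i q else 0 := fun i =>
    homogeneousComponent_of_mem (hp.mul (homogeneousComponent_isHomogeneous i q))
  simp_rw [h]
  split_ifs with hdk
  · rw [Finset.sum_eq_single (k - d)]
    · rw [if_pos (by omega)]
    · intro b _ hb
      exact if_neg (by omega)
    · intro hb
      rw [Finset.mem_range, not_lt] at hb
      rw [homogeneousComponent_eq_zero _ _ (by omega)]
      simp
  · exact Finset.sum_eq_zero fun b _ => if_neg (by omega)

theorem homogeneousComponent_mem_invRing {n : ℕ}
    {G : Subgroup (Matrix.GeneralLinearGroup (Fin n) ℂ)} {p : MvPolynomial (Fin n) ℂ}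
    (hp : p ∈ invRing G) (k : ℕ) : homogeneousComponent k p ∈ invRing G := by
  intro σ hσ
  have h := hp σ hσ
  conv_rhs => rw [← h, ← sum_homogeneousComponent p, map_sum, map_sum]
  have h : ∀ i, homogeneousComponent k (subst σ.val (homogeneousComponent i p)) =
      if k = i then subst σ.val (homogeneousComponent i p) else 0 := fun i =>
    homogeneousComponent_of_mem (subst_isHomogeneous _ (homogeneousComponent_isHomogeneous i p))
  simp_rw [h]
  rw [Finset.sum_ite_eq]
  split_ifs with hk
  · rfl
  · rw [Finset.mem_range, not_lt] at hk
    rw [homogeneousComponent_eq_zero _ _ (by omega), map_zero]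

theorem isHomogeneous_aeval_of_isWeightedHomogeneous {n m : ℕ}
    {f : Fin m → MvPolynomial (Fin n) ℂ} {w : Fin m → ℕ} (hf : ∀ i, (f i).IsHomogeneous (w i))
    {q : MvPolynomial (Fin m) ℂ} {k : ℕ} (hq : q.IsWeightedHomogeneous w k) :
    (aeval f q).IsHomogeneous k := by
  rw [q.as_sum, map_sum]
  refine IsHomogeneous.sum _ _ _ fun d hd => ?_
  rw [aeval_monomial, ← hq (mem_support_iff.1 hd), Finsupp.weight_apply]
  refine IsHomogeneous.C_mul (IsHomogeneous.prod _ _ _ fun i _ => ?_) _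
  beta_reduce
  rw [smul_eq_mul, mul_comm]
  exact (hf i).pow _

/-- Divisibility of Jacobians replaces averaging over the group: the coefficients in Euler's
identity are already invariant, so the induction on `k` closes without a Reynolds operator. -/
theorem degPart_invRing_eq_map {n : ℕ} {G : Subgroup (Matrix.GeneralLinearGroup (Fin n) ℂ)}
    {f : Fin n → MvPolynomial (Fin n) ℂ} {w : Fin n → ℕ} (hw : ∀ i, 0 < w i)
    (hf : ∀ i, (f i).IsHomogeneous (w i)) (hinv : ∀ i, f i ∈ invRing G) (hJ : jacobian f ≠ 0)
    (hdvd : ∀ h : Fin n → MvPolynomial (Fin n) ℂ, (∀ i, h i ∈ invRing G) →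
      jacobian f ∣ jacobian h) (k : ℕ) :
    degPart (invRing G) k = (weightedHomogeneousSubmodule ℂ w k).map (aeval f).toLinearMap := by
  apply le_antisymm
  · induction k using Nat.strong_induction_on with
    | _ k ih =>
    rintro p ⟨hp, hpk⟩
    rw [SetLike.mem_coe, Subalgebra.mem_toSubmodule] at hp
    rw [SetLike.mem_coe, mem_homogeneousSubmodule] at hpk
    obtain rfl | hk := Nat.eq_zero_or_pos k
    · rw [totalDegree_eq_zero_iff_eq_C.1 (Nat.le_zero.1 hpk.totalDegree_le)]
      exact ⟨C (coeff 0 p), isWeightedHomogeneous_C w _, by simp⟩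
    have hupd : ∀ i a, Function.update f i p a ∈ invRing G := by
      intro i a
      by_cases ha : a = i
      · subst ha; simpa using hp
      · simpa [ha] using hinv a
    choose g hg using fun i => hdvd _ (hupd i)
    -- Numerator and denominator of `g i` satisfy the same transformation law, so the determinant
    -- factor cancels.
    have hginv : ∀ i, g i ∈ invRing G := by
      intro i σ hσ
      have h1 := jacobian_subst σ.val (Function.update f i p) fun a => hupd i a σ hσ
      have h2 := jacobian_subst σ.val f fun a => hinv a σ hσ
      rw [hg i, map_mul, mul_right_comm, ← h2] at h1
      exact (mul_left_cancel₀ hJ h1).symm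
    -- Euler's identity for `p` and for each `f i`, linked by Cramer's rule after multiplication by
    -- the Jacobian.
    have hsum : (k : MvPolynomial (Fin n) ℂ) * p = ∑ i, (w i : MvPolynomial (Fin n) ℂ) * (f i * g i) := by
      apply mul_left_cancel₀ hJ
      have hE := hpk.sum_X_mul_pderiv
      rw [nsmul_eq_mul] at hE
      calc jacobian f * (k * p) = ∑ j, X j * (jacobian f * pderiv j p) := by
            rw [← hE, Finset.mul_sum]
            exact Finset.sum_congr rfl fun _ _ => by ring
        _ = ∑ j, ∑ i, jacobian f * g i * (X j * pderiv j (f i)) := by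
            refine Finset.sum_congr rfl fun j _ => ?_
            rw [← sum_jacobian_update f p j, Finset.mul_sum]
            exact Finset.sum_congr rfl fun i _ => by rw [hg i]; ring
        _ = ∑ i, jacobian f * g i * (w i * f i) := by
            rw [Finset.sum_comm]
            refine Finset.sum_congr rfl fun i _ => ?_
            rw [← Finset.mul_sum, (hf i).sum_X_mul_pderiv, nsmul_eq_mul]
        _ = _ := by
            rw [Finset.mul_sum]
            exact Finset.sum_congr rfl fun _ _ => by ring
    -- The `g i` need not be homogeneous, so only the degree-`k` part of `f i * g i` is used. It is
    -- `f i` times an invariant of degree `k - w i < k`, or zero when `w i > k`.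
    have hq : ∀ i, ∃ q ∈ weightedHomogeneousSubmodule ℂ w k,
        aeval f q = if w i ≤ k then f i * homogeneousComponent (k - w i) (g i) else 0 := by
      intro i
      split_ifs with hik
      · obtain ⟨q, hq, hqe⟩ := ih (k - w i) (by have := hw i; omega)
          (show homogeneousComponent (k - w i) (g i) ∈ degPart (invRing G) (k - w i) from
            ⟨homogeneousComponent_mem_invRing (hginv i) _,
              homogeneousComponent_isHomogeneous _ _⟩)
        refine ⟨X i * q, ?_, ?_⟩
        · have := (isWeightedHomogeneous_X ℂ w i).mul hq
          rwa [Nat.add_sub_cancel' hik] at this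
        · rw [map_mul, aeval_X, ← hqe]
          rfl
      · exact ⟨0, zero_mem _, map_zero _⟩
    choose q hqm hqe using hq
    refine ⟨(k : ℂ)⁻¹ • ∑ i, (w i : ℂ) • q i,
      Submodule.smul_mem _ _ (Submodule.sum_mem _ fun i _ => Submodule.smul_mem _ _ (hqm i)), ?_⟩
    have hk0 : (k : ℂ) ≠ 0 := by exact_mod_cast hk.ne'
    have hcomp := congrArg (homogeneousComponent k) hsum
    have hcast : ∀ m : ℕ, (m : MvPolynomial (Fin n) ℂ) = C (m : ℂ) := fun m => (map_natCast C m).symm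
    simp only [map_sum, hcast, homogeneousComponent_C_mul,
      homogeneousComponent_mul_of_isHomogeneous (hf _), ← hqe,
      homogeneousComponent_eq_self hpk] at hcomp
    rw [AlgHom.toLinearMap_apply, map_smul, map_sum, inv_smul_eq_iff₀ hk0, smul_eq_C_mul, hcomp]
    exact Finset.sum_congr rfl fun i _ => by rw [map_smul, smul_eq_C_mul]
  · rintro _ ⟨q, hq, rfl⟩
    refine ⟨?_, isHomogeneous_aeval_of_isWeightedHomogeneous hf hq⟩
    rw [AlgHom.toLinearMap_apply, SetLike.mem_coe, Subalgebra.mem_toSubmodule]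
    have : Set.range f ⊆ invRing G := Set.range_subset_iff.2 hinv
    apply Algebra.adjoin_le this
    rw [Algebra.adjoin_range_eq_range_aeval]
    exact ⟨q, rfl⟩

/-! ### Hilbert series -/

theorem finrank_weightedHomogeneousSubmodule {n : ℕ} (w : Fin n → ℕ) (k : ℕ) :
    Module.finrank ℂ (weightedHomogeneousSubmodule ℂ w k) =
      Nat.card {d : Fin n →₀ ℕ | Finsupp.weight w d = k} := by
  rw [weightedHomogeneousSubmodule_eq_finsupp_supported]
  exact Module.finrank_eq_nat_card_basis
    (basisRestrictSupport ℂ {d : Fin n →₀ ℕ | Finsupp.weight w d = k})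

theorem mk_dvd_mul_one_sub_X_pow {w : ℕ} (hw : 0 < w) :
    (PowerSeries.mk fun k => if w ∣ k then (1 : ℚ) else 0) * (1 - PowerSeries.X ^ w) = 1 := by
  ext k
  rw [mul_sub, mul_one, map_sub, PowerSeries.coeff_mul_X_pow', PowerSeries.coeff_one]
  simp only [PowerSeries.coeff_mk]
  rcases Nat.eq_zero_or_pos k with rfl | hk
  · simp [hw.ne']
  · rw [if_neg hk.ne']
    split_ifs with h1 h2 h3 h2 h3
    · simp
    · exact absurd (Nat.dvd_sub h1 dvd_rfl) h3
    · exact absurd (Nat.le_of_dvd hk h1) h2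
    · exact absurd ((Nat.dvd_sub_iff_left h2 dvd_rfl).1 h3) h1
    · simp
    · simp

/-- The coefficient counts families `l` with sum `k` and `w i ∣ l i`; the bijection is `d ↦ (w i * d
i)`. -/
theorem coeff_prod_mk_dvd {n : ℕ} {w : Fin n → ℕ} (hw : ∀ i, 0 < w i) (k : ℕ) :
    PowerSeries.coeff k (∏ i, PowerSeries.mk fun k => if w i ∣ k then (1 : ℚ) else 0) =
      Nat.card {d : Fin n →₀ ℕ | Finsupp.weight w d = k} := by
  rw [PowerSeries.coeff_prod]
  simp only [PowerSeries.coeff_mk]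
  have hprod : ∀ l : Fin n →₀ ℕ, (∏ i, if w i ∣ l i then (1 : ℚ) else 0) =
      if ∀ i, w i ∣ l i then 1 else 0 := fun l => by simp [Finset.prod_ite_zero]
  simp_rw [hprod]
  rw [Finset.sum_boole, ← Nat.card_eq_finsetCard]
  congr 1
  symm
  refine Nat.card_eq_of_bijective (fun d => ⟨Finsupp.equivFunOnFinite.symm fun i => w i * d.1 i, ?_⟩)
    ⟨?_, ?_⟩
  · have hd := d.2
    rw [Set.mem_ofPred_eq, Finsupp.weight_apply, Finsupp.sum_fintype _ _ (by simp)] at hd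
    rw [Finset.mem_filter, Finset.mem_finsuppAntidiag]
    refine ⟨⟨?_, Finset.subset_univ _⟩, fun i => Dvd.intro _ rfl⟩
    exact Eq.trans (Finset.sum_congr rfl fun i _ => by simp [mul_comm]) hd
  · intro d d' h
    ext i
    have := DFunLike.congr_fun (congrArg Subtype.val h) i
    exact Nat.eq_of_mul_eq_mul_left (hw i) this
  · rintro ⟨l, hl⟩
    rw [Finset.mem_filter, Finset.mem_finsuppAntidiag] at hl
    refine ⟨⟨Finsupp.equivFunOnFinite.symm fun i => l i / w i, ?_⟩, ?_⟩
    · rw [Set.mem_ofPred_eq, Finsupp.weight_apply, Finsupp.sum_fintype _ _ (by simp), ← hl.1.1]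
      exact Finset.sum_congr rfl fun i _ => by simpa using Nat.div_mul_cancel (hl.2 i)
    · ext i
      exact Nat.mul_div_cancel' (hl.2 i)

/-- Algebraic independence makes `aeval f` injective, so the dimension in degree `k` is the number
of monomials of weighted degree `k`. -/
theorem hilbertSeries_eq_of_degPart_eq_map {n : ℕ} {A : Subalgebra ℂ (MvPolynomial (Fin n) ℂ)}
    {f : Fin n → MvPolynomial (Fin n) ℂ} {w : Fin n → ℕ} (hw : ∀ i, 0 < w i)
    (hf : AlgebraicIndependent ℂ f)
    (hA : ∀ k, degPart A k = (weightedHomogeneousSubmodule ℂ w k).map (aeval f).toLinearMap) :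
    hilbertSeries A = (∏ i, (1 - PowerSeries.X ^ w i))⁻¹ := by
  have hseries : hilbertSeries A =
      ∏ i, PowerSeries.mk fun k => if w i ∣ k then (1 : ℚ) else 0 := by
    ext k
    rw [coeff_prod_mk_dvd hw, hilbertSeries, PowerSeries.coeff_mk, hA,
      ← finrank_weightedHomogeneousSubmodule]
    exact congrArg Nat.cast (LinearEquiv.finrank_eq
      (Submodule.equivMapOfInjective (aeval f).toLinearMap hf _)).symm
  rw [hseries, PowerSeries.eq_inv_iff_mul_eq_one, ← Finset.prod_mul_distrib]
  · exact Finset.prod_eq_one fun i _ => mk_dvd_mul_one_sub_X_pow (hw i)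
  · simp [map_prod, (hw _).ne']

/-! ### Linear forms and mirrors -/

/-- The linear form `∑ j, v j * t_j`. -/
def vecForm {n : ℕ} (v : Fin n → ℂ) : MvPolynomial (Fin n) ℂ :=
  ∑ j, C (v j) * X j

theorem vecForm_smul {n : ℕ} (c : ℂ) (v : Fin n → ℂ) : vecForm (c • v) = C c * vecForm v := by
  simp [vecForm, Finset.mul_sum, mul_assoc]

theorem coeff_vecForm {n : ℕ} (v : Fin n → ℂ) (j : Fin n) :
    coeff (Finsupp.single j 1) (vecForm v) = v j := by
  rw [vecForm, coeff_sum, Finset.sum_eq_single j]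
  · simp
  · intro b _ hb
    rw [coeff_C_mul, coeff_X, if_neg, mul_zero]
    rwa [Finsupp.single_left_inj one_ne_zero]
  · simp

theorem vecForm_injective {n : ℕ} : Function.Injective (vecForm (n := n)) := fun u v h =>
  funext fun j => by rw [← coeff_vecForm u j, h, coeff_vecForm]

theorem vecForm_ne_zero {n : ℕ} {v : Fin n → ℂ} (hv : v ≠ 0) : vecForm v ≠ 0 := fun h =>
  hv (vecForm_injective (h.trans (by simp [vecForm])))

theorem isHomogeneous_vecForm {n : ℕ} (v : Fin n → ℂ) : (vecForm v).IsHomogeneous 1 :=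
  IsHomogeneous.sum _ _ _ fun j _ => isHomogeneous_C_mul_X _ j

theorem subst_vecForm {n : ℕ} (A : Matrix (Fin n) (Fin n) ℂ) (v : Fin n → ℂ) :
    subst A (vecForm v) = vecForm (Matrix.vecMul v A) := by
  simp only [vecForm, map_sum, map_mul, subst, algHom_C, aeval_X, linForm, Matrix.vecMul,
    dotProduct, Finset.mul_sum, Finset.sum_mul, algebraMap_eq]
  rw [Finset.sum_comm]
  exact Finset.sum_congr rfl fun _ _ => Finset.sum_congr rfl fun _ _ => by ring

theorem irreducible_vecForm {n : ℕ} {v : Fin n → ℂ} (hv : v ≠ 0) : Irreducible (vecForm v) := by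
  refine irreducible_of_totalDegree_eq_one
    ((isHomogeneous_vecForm v).totalDegree (vecForm_ne_zero hv)) fun x hx => ?_
  obtain ⟨j, hj⟩ := Function.ne_iff.1 hv
  have := hx (Finsupp.single j 1)
  rw [coeff_vecForm] at this
  exact isUnit_iff_ne_zero.2 fun h => hj (zero_dvd_iff.1 (h ▸ this))

/-- Linear forms are irreducible, and a quotient of two of them would have degree 0, hence be a
scalar. -/
theorem isRelPrime_vecForm {n : ℕ} {u v : Fin n → ℂ} (hu : u ≠ 0) (hv : v ≠ 0)
    (huv : ∀ c : ℂ, v ≠ c • u) : IsRelPrime (vecForm u) (vecForm v) := by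
  rw [(irreducible_vecForm hu).isRelPrime_iff_not_dvd]
  rintro ⟨q, hq⟩
  have hq0 : q ≠ 0 := by
    rintro rfl
    exact vecForm_ne_zero hv (by rw [hq, mul_zero])
  have hdeg := congrArg MvPolynomial.totalDegree hq
  rw [totalDegree_mul_of_isDomain (vecForm_ne_zero hu) hq0,
    (isHomogeneous_vecForm v).totalDegree (vecForm_ne_zero hv),
    (isHomogeneous_vecForm u).totalDegree (vecForm_ne_zero hu)] at hdeg
  rw [totalDegree_eq_zero_iff_eq_C.1 (by omega : q.totalDegree = 0), mul_comm,
    ← vecForm_smul] at hq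
  exact huv _ (vecForm_injective hq)

/-- Modulo `l` the substitution fixes every variable, hence every polynomial. -/
theorem dvd_subst_sub {n : ℕ} {A : Matrix (Fin n) (Fin n) ℂ} {l : MvPolynomial (Fin n) ℂ}
    (hA : ∀ i, l ∣ linForm A i - X i) (p : MvPolynomial (Fin n) ℂ) : l ∣ subst A p - p := by
  induction p using MvPolynomial.induction_on with
  | C a => simp [subst]
  | add p q hp hq =>
    rw [map_add, add_sub_add_comm]
    exact dvd_add hp hq
  | mul_X p i hp =>
    rw [map_mul]
    have h : subst A p * subst A (X i) - p * X i =
        (subst A p - p) * subst A (X i) + p * (linForm A i - X i) := by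
      simp only [subst, aeval_X]
      ring
    rw [h]
    exact dvd_add (hp.mul_right _) ((hA i).mul_left _)

/-- If `A` fixes the hyperplane `v = 0` pointwise and multiplies `v` by `c`, then a polynomial that
`A` multiplies by `c⁻¹` is divisible by every power `v ^ e` with `e` below the order of `c`. -/
theorem vecForm_pow_dvd {n : ℕ} {A : Matrix (Fin n) (Fin n) ℂ} {v : Fin n → ℂ} {c : ℂ}
    (hv : v ≠ 0) (u : Fin n → ℂ) (hA : A = 1 + Matrix.vecMulVec u v)
    (hc : Matrix.vecMul v A = c • v) {p : MvPolynomial (Fin n) ℂ} (hp : subst A p * C c = p)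
    {e : ℕ} (he : ∀ m ∈ Finset.Icc 1 e, c ^ m ≠ 1) : vecForm v ^ e ∣ p := by
  have hfix : ∀ i, vecForm v ∣ linForm A i - X i := by
    intro i
    refine ⟨C (u i), ?_⟩
    rw [hA, linForm, vecForm]
    simp only [Matrix.add_apply, map_add, add_mul, Finset.sum_add_distrib, Matrix.one_apply,
      Matrix.vecMulVec_apply]
    simp only [apply_ite C, map_one, map_zero, ite_mul, one_mul, zero_mul, Finset.sum_ite_eq,
      Finset.mem_univ, if_true, add_sub_cancel_left, map_mul, Finset.sum_mul]
    exact Finset.sum_congr rfl fun _ _ => by ring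
  induction e with
  | zero => simp
  | succ e ih =>
    obtain ⟨q, rfl⟩ := ih fun m hm => he m (Finset.Icc_subset_Icc_right (Nat.le_succ e) hm)
    rw [pow_succ]
    apply mul_dvd_mul_left
    have hce := he (e + 1) (by simp)
    -- Writing `p = v ^ e * q`, the factor `v ^ e` absorbs `c ^ e`, so `A` multiplies `q` by `c ^
    -- (-(e + 1))`. Since `A` is the identity modulo `v`, the form `v` divides `q * (1 - c ^ (e +
    -- 1))`, where the second factor is a unit.
    have hq : subst A q * C (c ^ (e + 1)) = q := by
      apply mul_left_cancel₀ (pow_ne_zero e (vecForm_ne_zero hv))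
      conv_rhs => rw [← hp]
      rw [map_mul (subst A), map_pow (subst A), subst_vecForm, hc, vecForm_smul, pow_succ, map_mul C,
        map_pow C]
      ring
    have h1 : (subst A q - q) * C (c ^ (e + 1)) = q * C (1 - c ^ (e + 1)) := by
      rw [sub_mul, hq, map_sub, map_one]
      ring
    have h2 : vecForm v ∣ q * C (1 - c ^ (e + 1)) := h1 ▸ (dvd_subst_sub hfix q).mul_right _
    exact (IsUnit.dvd_mul_right
      ((isUnit_iff_ne_zero.2 (sub_ne_zero.2 hce.symm)).map C)).1 h2

/-- Semi-invariance carries divisibility from one mirror to its whole orbit, so one reflection per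
orbit is enough. -/
theorem vecForm_pow_dvd_of_orbit {n : ℕ} {G : Subgroup (Matrix.GeneralLinearGroup (Fin n) ℂ)}
    {h : Fin n → MvPolynomial (Fin n) ℂ} (hh : ∀ i, h i ∈ invRing G) {v : Fin n → ℂ} {e : ℕ}
    (hv : vecForm v ^ e ∣ jacobian h) {σ : Matrix.GeneralLinearGroup (Fin n) ℂ} (hσ : σ ∈ G) :
    vecForm (Matrix.vecMul v σ.val) ^ e ∣ jacobian h := by
  rw [jacobian_subst σ.val h fun i => hh i σ hσ, ← subst_vecForm, ← map_pow]
  exact (map_dvd _ hv).mul_right _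

/-- The product of mirror powers divides every Jacobian. By `hcard`, the Jacobian of `f` has no room
for a further factor of positive degree, so it is that product up to a unit. -/
theorem jacobian_dvd_jacobian {n : ℕ} {G : Subgroup (Matrix.GeneralLinearGroup (Fin n) ℂ)}
    {f : Fin n → MvPolynomial (Fin n) ℂ} {w : Fin n → ℕ} (hf : ∀ i, (f i).IsHomogeneous (w i))
    (hinv : ∀ i, f i ∈ invRing G) (hJ : jacobian f ≠ 0) {ι : Type*} [Fintype ι]
    (v : ι → Fin n → ℂ) (e : ℕ) (hv0 : ∀ i, v i ≠ 0) (hv : ∀ i j, i ≠ j → ∀ c : ℂ, v j ≠ c • v i)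
    (hdvd : ∀ h : Fin n → MvPolynomial (Fin n) ℂ, (∀ i, h i ∈ invRing G) →
      ∀ i, vecForm (v i) ^ e ∣ jacobian h)
    (hcard : ∑ i, (w i - 1) ≤ Fintype.card ι * e)
    (h : Fin n → MvPolynomial (Fin n) ℂ) (hh : ∀ i, h i ∈ invRing G) :
    jacobian f ∣ jacobian h := by
  have hD : ∀ h : Fin n → MvPolynomial (Fin n) ℂ, (∀ i, h i ∈ invRing G) →
      ∏ i, vecForm (v i) ^ e ∣ jacobian h := fun h hh =>
    Fintype.prod_dvd_of_isRelPrime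
      (fun i j hij => (isRelPrime_vecForm (hv0 i) (hv0 j) (hv i j hij)).pow) (hdvd h hh)
  obtain ⟨q, hq⟩ := hD f hinv
  have hhom : (∏ i, vecForm (v i) ^ e).IsHomogeneous (∑ _i : ι, 1 * e) :=
    IsHomogeneous.prod _ _ _ fun i _ => (isHomogeneous_vecForm (v i)).pow e
  have hq0 : q ≠ 0 := by
    rintro rfl
    exact hJ (by rw [hq, mul_zero])
  have hD0 : ∏ i, vecForm (v i) ^ e ≠ 0 :=
    Finset.prod_ne_zero_iff.2 fun i _ => pow_ne_zero _ (vecForm_ne_zero (hv0 i))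
  have hdeg := totalDegree_jacobian_le f w hf
  rw [hq, totalDegree_mul_of_isDomain hD0 hq0, hhom.totalDegree hD0] at hdeg
  simp only [one_mul, Finset.sum_const, Finset.card_univ, smul_eq_mul] at hdeg
  have hqC := totalDegree_eq_zero_iff_eq_C.1 (by omega : q.totalDegree = 0)
  have hunit : IsUnit q := by
    rw [hqC]
    refine (isUnit_iff_ne_zero.2 fun h0 => hq0 ?_).map C
    rw [hqC, h0, map_zero]
  rw [hq, hunit.mul_right_dvd]
  exact hD h hh

/-! ### E-polynomials -/

theorem isHomogeneous_ePoly {n : ℕ} [NeZero n] (G : Subgroup (Matrix.GeneralLinearGroup (Fin n) ℂ))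
    (k : ℕ) : (ePoly G k).IsHomogeneous k := by
  refine IsHomogeneous.C_mul ?_ _
  refine finsum_induction (fun p : MvPolynomial (Fin n) ℂ => p.IsHomogeneous k)
    (isHomogeneous_zero _ _ _) (fun _ _ => IsHomogeneous.add) fun σ => ?_
  simpa using (isHomogeneous_linForm _ _).pow k

/-- Right multiplication by `σ` permutes the group and sends the first row of `τ` to that of `τ *
σ`. -/
theorem ePoly_mem_invRing {n : ℕ} [NeZero n] (G : Subgroup (Matrix.GeneralLinearGroup (Fin n) ℂ))
    [Finite G] (k : ℕ) : ePoly G k ∈ invRing G := by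
  intro σ hσ
  have := Fintype.ofFinite G
  rw [ePoly, map_mul, finsum_eq_sum_of_fintype, map_sum]
  congr 1
  · exact algHom_C _ _
  · refine Fintype.sum_equiv (Equiv.mulRight (⟨σ, hσ⟩ : G)) _ _ fun τ => ?_
    rw [map_pow]
    exact congrArg (· ^ k) (subst_vecForm σ.val (τ.1.val 0))

theorem eRing_properties {n : ℕ} [NeZero n]
    {G : Subgroup (Matrix.GeneralLinearGroup (Fin n) ℂ)} [Finite G] {w : Fin n → ℕ}
    (hw : ∀ i, 0 < w i) (hJ : jacobian (fun i => ePoly G (w i)) ≠ 0) {ι : Type*} [Fintype ι]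
    (v : ι → Fin n → ℂ) (e : ℕ) (hv0 : ∀ i, v i ≠ 0) (hv : ∀ i j, i ≠ j → ∀ c : ℂ, v j ≠ c • v i)
    (hdvd : ∀ h : Fin n → MvPolynomial (Fin n) ℂ, (∀ i, h i ∈ invRing G) →
      ∀ i, vecForm (v i) ^ e ∣ jacobian h)
    (hcard : ∑ i, (w i - 1) ≤ Fintype.card ι * e) :
    MinimallyGeneratedByWeights G (Set.range w) ∧ eRing G = invRing G ∧
      hilbertSeries (eRing G) = (∏ i, (1 - PowerSeries.X ^ w i))⁻¹ := by
  have hhom : ∀ i, (ePoly G (w i)).IsHomogeneous (w i) := fun i => isHomogeneous_ePoly G _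
  have hinv : ∀ i, ePoly G (w i) ∈ invRing G := fun i => ePoly_mem_invRing G _
  have hdeg := degPart_invRing_eq_map hw hhom hinv hJ
    (jacobian_dvd_jacobian hhom hinv hJ v e hv0 hv hdvd hcard)
  have hind := algebraicIndependent_of_jacobian _ hJ
  have hinvle : invRing G ≤ Algebra.adjoin ℂ (ePoly G '' Set.range w) := by
    intro p hp
    rw [← sum_homogeneousComponent p]
    refine Subalgebra.sum_mem _ fun k _ => ?_
    have : homogeneousComponent k p ∈ degPart (invRing G) k :=
      ⟨homogeneousComponent_mem_invRing hp k, homogeneousComponent_isHomogeneous k p⟩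
    rw [hdeg] at this
    obtain ⟨q, -, hq⟩ := this
    rw [← Set.range_comp, show ePoly G ∘ w = fun i => ePoly G (w i) from rfl,
      Algebra.adjoin_range_eq_range_aeval]
    exact ⟨q, hq⟩
  have hle : Algebra.adjoin ℂ (ePoly G '' Set.range w) ≤ eRing G :=
    Algebra.adjoin_mono (Set.image_subset_range _ _)
  have hEle : eRing G ≤ invRing G :=
    Algebra.adjoin_le (Set.range_subset_iff.2 fun k => ePoly_mem_invRing G k)
  have hE : eRing G = invRing G := le_antisymm hEle (hinvle.trans hle)
  refine ⟨⟨le_antisymm hle (hEle.trans hinvle), fun W' hW' heq => ?_⟩, hE,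
    hilbertSeries_eq_of_degPart_eq_map hw hind (by rwa [hE])⟩
  obtain ⟨_, ⟨i, rfl⟩, hi⟩ := Set.exists_of_ssubset hW'
  -- If the weights in `W'` sufficed, the omitted generator would lie in the algebra generated by
  -- other members of an independent family.
  have htr := hind.transcendental_adjoin (s := w ⁻¹' W') (i := i) hi
  have himg : (fun i => ePoly G (w i)) '' (w ⁻¹' W') = ePoly G '' W' := by
    rw [show (fun i => ePoly G (w i)) = ePoly G ∘ w from rfl, Set.image_comp,
      Set.image_preimage_eq_of_subset hW'.subset]
  refine htr (isAlgebraic_algebraMap (⟨ePoly G (w i), ?_⟩ :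
    Algebra.adjoin ℂ ((fun i => ePoly G (w i)) '' (w ⁻¹' W'))))
  rw [himg, heq]
  exact Algebra.subset_adjoin ⟨_, rfl⟩

/-! ### The ternary group -/

theorem isPrimitiveRoot_omega : IsPrimitiveRoot omega 3 :=
  Complex.isPrimitiveRoot_exp 3 (by norm_num)

theorem omega_sum : 1 + omega + omega ^ 2 = 0 := by
  have := isPrimitiveRoot_omega.geom_sum_eq_zero (by norm_num)
  simpa [Finset.sum_range_succ] using this

/-- This puts all matrix entries in `ℚ(ω)`, so that matrix identities become polynomial identities
modulo `1 + ω + ω²`. -/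
theorem I_mul_sqrt_three : Complex.I * (Real.sqrt 3 : ℂ) = 1 + 2 * omega := by
  have h : omega = Complex.exp (((Real.pi - Real.pi / 3 : ℝ) : ℂ) * Complex.I) := by
    rw [omega]
    congr 1
    push_cast
    ring
  rw [h, Complex.exp_mul_I, ← Complex.ofReal_cos, ← Complex.ofReal_sin, Real.cos_pi_sub,
    Real.sin_pi_sub, Real.cos_pi_div_three, Real.sin_pi_div_three]
  push_cast
  ring

theorem ternaryM_eq : ternaryM = !![-(1 + 2 * omega) / 3, -(1 + 2 * omega) * 2 / 3;
    -(1 + 2 * omega) / 3, (1 + 2 * omega) / 3] := by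
  have h3 : (1 + 2 * omega) * (1 + 2 * omega) = -3 := by linear_combination 4 * omega_sum
  have h0 : 1 + 2 * omega ≠ 0 := fun h => by norm_num [h] at h3
  have h : 1 / (1 + 2 * omega) = -(1 + 2 * omega) / 3 := by
    rw [div_eq_iff h0]; linear_combination h3 / 3
  rw [ternaryM, I_mul_sqrt_three, h]
  ext i j
  fin_cases i <;> fin_cases j <;> simp <;> ring

/-! ### Relations, normal form and order of the ternary group -/

theorem ternaryA_mul_self : ternaryA * ternaryA = -1 := Units.ext ternaryM_mul_self

theorem ternaryB_pow_val (j : ℕ) : (ternaryB ^ j).val = !![1, 0; 0, omega ^ j] := by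
  induction j with
  | zero => ext i j; fin_cases i <;> fin_cases j <;> simp
  | succ j ih =>
    rw [pow_succ, Units.val_mul, ih]
    ext i j
    fin_cases i <;> fin_cases j <;> simp [ternaryB, Matrix.mul_apply, Fin.sum_univ_two, pow_succ]

theorem ternaryB_pow_three : ternaryB ^ 3 = 1 := by
  ext i j
  rw [ternaryB_pow_val, omega_pow]
  fin_cases i <;> fin_cases j <;> simp

/-- Together with `ternaryAB2A`, `A² = -1` and `B³ = 1`, this reduces every word to one with at most
one `A`, leaving `2 * 3 * (1 + 3) = 24` normal forms. -/
theorem ternaryABA : ternaryA * ternaryB * ternaryA = ternaryB ^ 2 * ternaryA * ternaryB ^ 2 := by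
  apply Units.ext
  simp only [Units.val_mul, ternaryB_pow_val]
  have h := omega_sum
  rw [show ternaryA.val = ternaryM from rfl, show ternaryB.val = !![1, 0; 0, omega] from rfl,
    ternaryM_eq]
  ext i j
  fin_cases i <;> fin_cases j <;> simp [Matrix.mul_apply, Fin.sum_univ_two] <;> grind
theorem ternaryAB2A :
    ternaryA * ternaryB ^ 2 * ternaryA = -(ternaryB * ternaryA * ternaryB) := by
  apply Units.ext
  simp only [Units.val_mul, Units.val_neg, ternaryB_pow_val]
  have h := omega_sum
  rw [show ternaryA.val = ternaryM from rfl, show ternaryB.val = !![1, 0; 0, omega] from rfl,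
    ternaryM_eq]
  ext i j
  fin_cases i <;> fin_cases j <;> simp [Matrix.mul_apply, Fin.sum_univ_two] <;> grind

/-- The element `± B ^ j` or `± B ^ j * A * B ^ l` of the ternary group. -/
def ternaryElt (x : Fin 2 × Fin 3 × Option (Fin 3)) : Matrix.GeneralLinearGroup (Fin 2) ℂ :=
  (-1) ^ x.1.val * (ternaryB ^ x.2.1.val * x.2.2.elim 1 fun l => ternaryA * ternaryB ^ l.val)

theorem ternaryElt_range_none (s j : ℕ) : (-1) ^ s * ternaryB ^ j ∈ Set.range ternaryElt :=
  ⟨(⟨s % 2, Nat.mod_lt _ (by norm_num)⟩, ⟨j % 3, Nat.mod_lt _ (by norm_num)⟩, none), by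
    simp only [ternaryElt, Option.elim_none, mul_one]
    rw [← pow_eq_pow_mod s (neg_one_sq), ← pow_eq_pow_mod j ternaryB_pow_three]⟩

theorem ternaryElt_range_some (s j l : ℕ) :
    (-1) ^ s * (ternaryB ^ j * (ternaryA * ternaryB ^ l)) ∈ Set.range ternaryElt :=
  ⟨(⟨s % 2, Nat.mod_lt _ (by norm_num)⟩, ⟨j % 3, Nat.mod_lt _ (by norm_num)⟩,
    some ⟨l % 3, Nat.mod_lt _ (by norm_num)⟩), by
    simp only [ternaryElt, Option.elim_some]
    rw [← pow_eq_pow_mod s (neg_one_sq), ← pow_eq_pow_mod j ternaryB_pow_three,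
      ← pow_eq_pow_mod l ternaryB_pow_three]⟩

theorem ternaryElt_mul_B {σ} (hσ : σ ∈ Set.range ternaryElt) :
    σ * ternaryB ∈ Set.range ternaryElt := by
  obtain ⟨⟨s, j, _ | l⟩, rfl⟩ := hσ
  · convert ternaryElt_range_none s (j + 1) using 1
    simp [ternaryElt, pow_succ, mul_assoc]
  · convert ternaryElt_range_some s j (l + 1) using 1
    simp [ternaryElt, pow_succ, mul_assoc]

theorem ternaryElt_neg {σ} (hσ : σ ∈ Set.range ternaryElt) : -σ ∈ Set.range ternaryElt := by
  obtain ⟨⟨s, j, _ | l⟩, rfl⟩ := hσ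
  · convert ternaryElt_range_none (s + 1) j using 1
    simp [ternaryElt, pow_succ]
  · convert ternaryElt_range_some (s + 1) j l using 1
    simp [ternaryElt, pow_succ]

theorem ternaryElt_mul_A {σ} (hσ : σ ∈ Set.range ternaryElt) :
    σ * ternaryA ∈ Set.range ternaryElt := by
  obtain ⟨⟨s, j, _ | l⟩, rfl⟩ := hσ
  · convert ternaryElt_range_some s j 0 using 1
    simp [ternaryElt, mul_assoc]
  · have h1 := ternaryABA
    have h2 := ternaryAB2A
    rw [mul_assoc] at h1 h2
    fin_cases l
    · convert ternaryElt_range_none (s + 1) j using 1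
      simp [ternaryElt, mul_assoc, ternaryA_mul_self, pow_succ]
    · convert ternaryElt_range_some s (j + 2) 2 using 1
      simp [ternaryElt, mul_assoc, h1, pow_add]
    · convert ternaryElt_range_some (s + 1) (j + 1) 1 using 1
      simp [ternaryElt, mul_assoc, h2, pow_add]

theorem ternaryA_mem : ternaryA ∈ ternaryGroup := Subgroup.subset_closure (by simp)

theorem ternaryB_mem : ternaryB ∈ ternaryGroup := Subgroup.subset_closure (by simp)

theorem ternaryElt_mem (x) : ternaryElt x ∈ ternaryGroup := by
  obtain ⟨s, j, o⟩ := x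
  have hneg : (-1 : Matrix.GeneralLinearGroup (Fin 2) ℂ) ∈ ternaryGroup :=
    ternaryA_mul_self ▸ mul_mem ternaryA_mem ternaryA_mem
  refine mul_mem (pow_mem hneg _) (mul_mem (pow_mem ternaryB_mem _) ?_)
  rcases o with _ | l
  · exact one_mem _
  · exact mul_mem ternaryA_mem (pow_mem ternaryB_mem _)

theorem mem_range_ternaryElt {σ} (hσ : σ ∈ ternaryGroup) : σ ∈ Set.range ternaryElt := by
  induction hσ using Subgroup.closure_induction_right with
  | one => simpa using ternaryElt_range_none 0 0
  | mul_right x _ y hy ih =>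
    rcases hy with rfl | rfl
    · exact ternaryElt_mul_A ih
    · exact ternaryElt_mul_B ih
  | mul_inv_cancel x _ y hy ih =>
    rcases hy with rfl | rfl
    · rw [inv_eq_of_mul_eq_one_right (b := -ternaryA) (by rw [mul_neg, ternaryA_mul_self, neg_neg]),
        mul_neg]
      exact ternaryElt_neg (ternaryElt_mul_A ih)
    · rw [inv_eq_of_mul_eq_one_right (b := ternaryB * ternaryB)
        (by rw [← mul_assoc, ← pow_three', ternaryB_pow_three]), ← mul_assoc]
      exact ternaryElt_mul_B (ternaryElt_mul_B ih)

/-- The first rows of the elements of the ternary group, up to sign. -/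
def ternaryRow (o : Option (Fin 3)) : Fin 2 → ℂ :=
  o.elim ![1, 0] fun l =>
    ![-(1 + 2 * omega) / 3, -(1 + 2 * omega) * 2 / 3 * omega ^ l.val]

/-- Left multiplication by a power of `B` does not change the first row, so only the sign and the
part from `A` onwards matter. -/
theorem ternaryElt_row (x) :
    (ternaryElt x).val 0 = (-1 : ℂ) ^ x.1.val • ternaryRow x.2.2 := by
  obtain ⟨s, j, o⟩ := x
  have hs : ((-1 : Matrix.GeneralLinearGroup (Fin 2) ℂ) ^ s.val).val =
      (-1 : ℂ) ^ s.val • (1 : Matrix (Fin 2) (Fin 2) ℂ) := by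
    fin_cases s <;> simp
  simp only [ternaryElt, Units.val_mul, hs, ternaryB_pow_val, smul_mul_assoc, one_mul]
  ext i
  rcases o with _ | l
  · fin_cases i <;> simp [ternaryRow]
  · have hAB : (ternaryA * ternaryB ^ l.val).val 0 = ternaryRow (some l) := by
      rw [Units.val_mul, ternaryB_pow_val, show ternaryA.val = ternaryM from rfl, ternaryM_eq]
      ext i
      fin_cases i <;> simp [ternaryRow, Matrix.mul_apply, Fin.sum_univ_two]
    rw [← hAB]
    simp only [Option.elim_some]
    generalize (ternaryA * ternaryB ^ l.val).val = M
    fin_cases i <;> simp [Matrix.vecMul, dotProduct, Fin.sum_univ_two]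

theorem neg_one_pow_fin_two_injective : Function.Injective fun s : Fin 2 => (-1 : ℂ) ^ s.val := by
  intro s s' h
  fin_cases s <;> fin_cases s' <;> norm_num at h <;> rfl

theorem neg_one_pow_mul_self (s : ℕ) : (-1 : ℂ) ^ s * (-1 : ℂ) ^ s = 1 := by
  rw [← mul_pow]; simp

/-- The first row determines the sign and `o`: the square of its first entry is `1` without `A` and
`-1/3` with `A`, and its second entry reveals `l`. After cancellation, `j` is read off `B ^ j`. -/
theorem ternaryElt_injective : Function.Injective ternaryElt := by
  rintro ⟨s, j, o⟩ ⟨s', j', o'⟩ h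
  have h3 : (1 + 2 * omega) * (1 + 2 * omega) = -3 := by linear_combination 4 * omega_sum
  have h0 : 1 + 2 * omega ≠ 0 := fun h => by norm_num [h] at h3
  have hrow := congrArg (fun σ => σ.val 0) h
  simp only [ternaryElt_row] at hrow
  have r0 := congrFun hrow 0
  have r1 := congrFun hrow 1
  have e := neg_one_pow_mul_self s.val
  have e' := neg_one_pow_mul_self s'.val
  obtain ⟨rfl, rfl⟩ : s = s' ∧ o = o' := by
    rcases o with _ | l <;> rcases o' with _ | l' <;>
      simp only [ternaryRow, Option.elim_none, Option.elim_some, Pi.smul_apply, smul_eq_mul,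
        Matrix.cons_val_zero, Matrix.cons_val_one, mul_one] at r0 r1
    · exact ⟨neg_one_pow_fin_two_injective r0, rfl⟩
    · exfalso
      rw [r0] at e
      have : (-1 : ℂ) / 3 = 1 := by linear_combination e - (1 + 2 * omega) ^ 2 / 9 * e' - h3 / 9
      norm_num at this
    · exfalso
      rw [← r0] at e'
      have : (-1 : ℂ) / 3 = 1 := by linear_combination e' - (1 + 2 * omega) ^ 2 / 9 * e - h3 / 9
      norm_num at this
    · have hss : (-1 : ℂ) ^ s.val = (-1) ^ s'.val :=
        mul_right_cancel₀ (div_ne_zero (neg_ne_zero.2 h0) (by norm_num)) r0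
      rw [hss] at r1
      have hl := mul_left_cancel₀ (div_ne_zero (mul_ne_zero (neg_ne_zero.2 h0) two_ne_zero)
        (by norm_num)) (mul_left_cancel₀ (pow_ne_zero _ (by norm_num)) r1)
      exact ⟨neg_one_pow_fin_two_injective hss,
        congrArg some (Fin.ext (isPrimitiveRoot_omega.pow_inj l.2 l'.2 hl))⟩
  have hB : ternaryB ^ j.val = ternaryB ^ j'.val := mul_right_cancel (mul_left_cancel h)
  have hj := congrArg (fun σ => σ.val 1 1) hB
  simp only [ternaryB_pow_val] at hj
  rw [Fin.ext (isPrimitiveRoot_omega.pow_inj j.2 j'.2 (by simpa using hj))]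

/-- The parametrization of the ternary group by `ternaryElt`. -/
def ternaryEquiv : (Fin 2 × Fin 3 × Option (Fin 3)) ≃ ternaryGroup :=
  Equiv.ofBijective (fun x => ⟨ternaryElt x, ternaryElt_mem x⟩)
    ⟨fun _ _ h => ternaryElt_injective (congrArg Subtype.val h), fun σ => by
      obtain ⟨x, hx⟩ := mem_range_ternaryElt σ.2
      exact ⟨x, Subtype.ext hx⟩⟩

theorem card_ternaryGroup : Nat.card ternaryGroup = 24 := by
  rw [← Nat.card_congr ternaryEquiv]
  simp

instance : Finite ternaryGroup := Finite.of_equiv _ ternaryEquiv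

/-! ### E-polynomials of the ternary group and their Jacobian -/

theorem ePoly_ternaryGroup {k : ℕ} (hk : Even k) :
    ePoly ternaryGroup k = C (1 / 4) * ∑ o, vecForm (ternaryRow o) ^ k := by
  rw [ePoly, ← finsum_comp_equiv ternaryEquiv, finsum_eq_sum_of_fintype, card_ternaryGroup]
  have h : ∀ x, linForm (ternaryEquiv x).1.val 0 ^ k = vecForm (ternaryRow x.2.2) ^ k := by
    intro x
    have : linForm (ternaryEquiv x).1.val 0 = vecForm ((ternaryElt x).val 0) := rfl
    rw [this, ternaryElt_row, vecForm_smul, mul_pow, ← map_pow, ← pow_mul, mul_comm x.1.val,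
      pow_mul, hk.neg_one_pow, one_pow, map_one, one_mul]
  simp_rw [h]
  rw [Fintype.sum_prod_type]
  simp_rw [Fintype.sum_prod_type]
  -- Each row occurs `2 * 3 = 6` times up to sign, and `6 / 24 = 1 / 4`.
  simp only [Finset.sum_const, Finset.card_univ, Fintype.card_fin, ← mul_smul]
  rw [nsmul_eq_mul, ← mul_assoc, ← map_natCast (C (R := ℂ)), ← map_mul]
  norm_num

theorem eval_vecForm {n : ℕ} (p v : Fin n → ℂ) : eval p (vecForm v) = ∑ j, v j * p j := by
  simp [vecForm]

theorem eval_pderiv_vecForm_pow {n : ℕ} (p v : Fin n → ℂ) (j : Fin n) (k : ℕ) :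
    eval p (pderiv j (vecForm v ^ k)) = k * (∑ i, v i * p i) ^ (k - 1) * v j := by
  have h : pderiv j (vecForm v) = C (v j) := pderiv_linForm (fun _ => v) j j
  simp [h, eval_vecForm, mul_assoc]

theorem eval_pderiv_ePoly_ternaryGroup {k : ℕ} (hk : Even k) (p : Fin 2 → ℂ) (j : Fin 2) :
    eval p (pderiv j (ePoly ternaryGroup k)) =
      k / 4 * ∑ o, (∑ i, ternaryRow o i * p i) ^ (k - 1) * ternaryRow o j := by
  rw [ePoly_ternaryGroup hk, pderiv_C_mul, map_mul, eval_C, map_sum, map_sum]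
  simp_rw [eval_pderiv_vecForm_pow, mul_assoc, ← Finset.mul_sum]
  ring

theorem jacobian_ternaryGroup_ne_zero :
    jacobian (fun i => ePoly ternaryGroup (![4, 6] i)) ≠ 0 := by
  intro h
  -- At `(0, 1)` the sums of powers of `ω` make the Jacobian matrix diagonal: weight 4 keeps only
  -- the derivative in `t_0`, weight 6 only that in `t_1`.
  have h := congrArg (eval ![0, 1]) h
  rw [jacobian, RingHom.map_det, Matrix.det_fin_two, map_zero] at h
  have e4 : Even 4 := by decide
  have e6 : Even 6 := by decide
  simp [eval_pderiv_ePoly_ternaryGroup e4, eval_pderiv_ePoly_ternaryGroup e6, Fin.sum_univ_two,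
    Fin.sum_univ_three, Fintype.sum_option, ternaryRow] at h
  have h1 := omega_sum
  grind

/-! ### Mirrors of the ternary group -/

/-- Linear forms that define the mirrors of the ternary group. -/
def ternaryMirror (o : Option (Fin 3)) : Fin 2 → ℂ :=
  o.elim ![0, 1] fun l => Matrix.vecMul ![0, 1] (ternaryA * ternaryB ^ l.val).val

theorem ternaryMirror_none : ternaryMirror none = ![0, 1] := rfl

theorem ternaryMirror_some (l : Fin 3) : ternaryMirror (some l) =
    ![-(1 + 2 * omega) / 3, (1 + 2 * omega) / 3 * omega ^ l.val] := by
  rw [ternaryMirror, Option.elim_some, Units.val_mul, ternaryB_pow_val,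
    show ternaryA.val = ternaryM from rfl, ternaryM_eq]
  ext i
  fin_cases i <;> simp [Matrix.vecMul, dotProduct, Matrix.mul_apply, Fin.sum_univ_two]

theorem ternaryMirror_ne_zero (o) : ternaryMirror o ≠ 0 := by
  have h1 := omega_sum
  intro h
  rcases o with _ | l
  · simpa [ternaryMirror] using congrFun h 1
  · have := congrFun h 0
    rw [ternaryMirror_some] at this
    simp only [Matrix.cons_val_zero, Pi.zero_apply] at this
    grind

theorem ternaryMirror_ne_smul (o o') (ho : o ≠ o') (c : ℂ) :
    ternaryMirror o' ≠ c • ternaryMirror o := by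
  have h1 := omega_sum
  have h3 : -(1 + 2 * omega) / 3 ≠ 0 := by grind
  intro h
  have e0 := congrFun h 0
  have e1 := congrFun h 1
  rcases o with _ | l <;> rcases o' with _ | l' <;>
    simp only [ternaryMirror_some, ternaryMirror_none, Pi.smul_apply, smul_eq_mul,
      Matrix.cons_val_zero, Matrix.cons_val_one, mul_zero, mul_one] at e0 e1
  · exact ho rfl
  · exact h3 e0
  · rw [(mul_eq_zero.1 e0.symm).resolve_right h3, zero_mul] at e1
    exact one_ne_zero e1
  · rw [right_eq_mul₀ h3] at e0
    rw [e0, one_mul] at e1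
    refine ho (congrArg some (Fin.ext (isPrimitiveRoot_omega.pow_inj l.2 l'.2 ?_)))
    refine (mul_left_cancel₀ (fun h0 => h3 ?_) e1).symm
    rw [neg_div, h0, neg_zero]

/-- `B` is a reflection of order 3 with mirror `t_1 = 0`, whence the exponent 2; the other three
mirrors are its translates by `A * B ^ l`. -/
theorem ternaryMirror_sq_dvd {h : Fin 2 → MvPolynomial (Fin 2) ℂ}
    (hh : ∀ i, h i ∈ invRing ternaryGroup) (o) : vecForm (ternaryMirror o) ^ 2 ∣ jacobian h := by
  have hdet : ternaryB.val.det = omega := by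
    simp [ternaryB, Matrix.det_fin_two]
  have hbase : vecForm ![0, 1] ^ 2 ∣ jacobian h := by
    refine vecForm_pow_dvd (A := ternaryB.val) (v := ![0, 1]) (c := omega) (ternaryMirror_ne_zero none)
      ![0, omega - 1] ?_ ?_ ?_ ?_
    · ext i j
      rw [Matrix.add_apply, Matrix.vecMulVec_apply]
      fin_cases i <;> fin_cases j <;> simp [ternaryB]
    · ext i
      fin_cases i <;> simp [ternaryB, Matrix.vecMul, dotProduct, Fin.sum_univ_two]
    · rw [← hdet]
      exact (jacobian_subst _ h fun i => hh i _ ternaryB_mem).symm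
    · intro m hm
      rw [Finset.mem_Icc] at hm
      exact isPrimitiveRoot_omega.pow_ne_one_of_pos_of_lt (by omega) (by omega)
  rcases o with _ | l
  · exact hbase
  · exact vecForm_pow_dvd_of_orbit hh hbase (mul_mem ternaryA_mem (pow_mem ternaryB_mem _))

theorem eRing_ternaryGroup :
    MinimallyGeneratedByWeights ternaryGroup {4, 6} ∧ eRing ternaryGroup = invRing ternaryGroup ∧
      hilbertSeries (eRing ternaryGroup) =
        ((1 - PowerSeries.X ^ 4) * (1 - PowerSeries.X ^ 6))⁻¹ := by
  -- The degree count is `(4 - 1) + (6 - 1) = 4 * 2`.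
  have := eRing_properties (G := ternaryGroup) (w := ![4, 6]) (by intro i; fin_cases i <;> simp)
    jacobian_ternaryGroup_ne_zero ternaryMirror 2 ternaryMirror_ne_zero ternaryMirror_ne_smul
    (fun _ hh => ternaryMirror_sq_dvd hh) (by simp [Fin.sum_univ_two])
  rwa [Fin.prod_univ_two, Matrix.range_cons, Matrix.range_cons, Matrix.range_empty,
    Set.union_empty] at this

/-! ### The Hilbert modular group -/

theorem isPrimitiveRoot_zeta : IsPrimitiveRoot zeta 5 :=
  Complex.isPrimitiveRoot_exp 5 (by norm_num)

/-- The sum `ζ + ζ⁴` is `2 cos(2π/5)`, and the known value of `cos(π/5)` fixes the sign of the root.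
All matrix entries thereby lie in `ℚ(ζ)`. -/
theorem sqrt_five : (Real.sqrt 5 : ℂ) = 1 + 2 * (zeta + zeta ^ 4) := by
  have h : zeta = Complex.exp (((2 * (Real.pi / 5) : ℝ) : ℂ) * Complex.I) := by
    rw [zeta]
    congr 1
    push_cast
    ring
  have h4 : zeta ^ 4 = Complex.exp (-((2 * (Real.pi / 5) : ℝ) : ℂ) * Complex.I) := by
    rw [neg_mul, Complex.exp_neg, ← h]
    exact eq_inv_of_mul_eq_one_left (by rw [← pow_succ, zeta_pow])
  have hcos : zeta + zeta ^ 4 = 2 * (Real.cos (2 * (Real.pi / 5)) : ℂ) := by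
    rw [h4, Complex.ofReal_cos, Complex.two_cos, ← h]
  have h5 : Real.sqrt 5 * Real.sqrt 5 = 5 := Real.mul_self_sqrt (by norm_num)
  have : Real.sqrt 5 = 1 + 2 * (2 * Real.cos (2 * (Real.pi / 5))) := by
    rw [Real.cos_two_mul, Real.cos_pi_div_five]
    linear_combination (-1 / 2 : ℝ) * h5
  rw [hcos]
  exact_mod_cast this

/-- `1/√5` as a polynomial in `ζ`. -/
def invSqrtFive : ℂ := (1 + 2 * (zeta + zeta ^ 4)) / 5

theorem invSqrtFive_sq : invSqrtFive ^ 2 = 1 / 5 := by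
  have := zeta_sum
  rw [invSqrtFive]
  grind

theorem invSqrtFive_ne_zero : invSqrtFive ≠ 0 := fun h => by
  have := invSqrtFive_sq
  norm_num [h] at this

theorem hilbertM_eq : hilbertM = !![invSqrtFive, 2 * invSqrtFive, 2 * invSqrtFive;
    invSqrtFive, invSqrtFive * (zeta + zeta ^ 4), invSqrtFive * (zeta ^ 2 + zeta ^ 3);
    invSqrtFive, invSqrtFive * (zeta ^ 2 + zeta ^ 3), invSqrtFive * (zeta + zeta ^ 4)] := by
  have h : 1 / (Real.sqrt 5 : ℂ) = invSqrtFive := by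
    have h2 : (Real.sqrt 5 : ℂ) = 5 * invSqrtFive := by rw [sqrt_five, invSqrtFive]; ring
    rw [h2, div_eq_iff (mul_ne_zero (by norm_num) invSqrtFive_ne_zero)]
    linear_combination -5 * invSqrtFive_sq
  rw [hilbertM, h]
  ext i j
  fin_cases i <;> fin_cases j <;> simp [mul_comm]

/-! ### Relations, normal form and order of the Hilbert modular group -/

/-- The permutation matrix that exchanges the last two coordinates. -/
def hilbertP : Matrix.GeneralLinearGroup (Fin 3) ℂ := -hilbertC

theorem hilbertP_val : hilbertP.val = !![1, 0, 0; 0, 0, 1; 0, 1, 0] := by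
  simp [hilbertP, hilbertC]

theorem hilbertA_val : hilbertA.val = hilbertM := rfl

theorem hilbertB_pow_val (j : ℕ) :
    (hilbertB ^ j).val = !![1, 0, 0; 0, (zeta ^ 2) ^ j, 0; 0, 0, (zeta ^ 3) ^ j] := by
  induction j with
  | zero => ext i j; fin_cases i <;> fin_cases j <;> simp
  | succ j ih =>
    rw [pow_succ, Units.val_mul, ih]
    ext i j
    fin_cases i <;> fin_cases j <;>
      simp [hilbertB, Matrix.mul_apply, Fin.sum_univ_three, pow_succ]

theorem hilbertB_pow_five : hilbertB ^ 5 = 1 := by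
  ext i j
  rw [hilbertB_pow_val, ← pow_mul, ← pow_mul, mul_comm, mul_comm 3, pow_mul, pow_mul, zeta_pow]
  fin_cases i <;> fin_cases j <;> simp

theorem hilbertA_mul_self : hilbertA * hilbertA = 1 := Units.ext hilbertM_mul_self

theorem hilbertP_mul_self : hilbertP * hilbertP = 1 := by
  apply Units.ext
  rw [Units.val_mul, hilbertP_val]
  ext i j
  fin_cases i <;> fin_cases j <;> simp [Matrix.mul_apply, Fin.sum_univ_three]

theorem hilbertA_mul_P : hilbertA * hilbertP = hilbertP * hilbertA := by
  apply Units.ext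
  rw [Units.val_mul, Units.val_mul, hilbertP_val, hilbertA_val, hilbertM_eq]
  ext i j
  fin_cases i <;> fin_cases j <;> simp [Matrix.mul_apply, Fin.sum_univ_three]

theorem hilbertB_mul_P : hilbertB * hilbertP = hilbertP * hilbertB ^ 4 := by
  have h := zeta_pow
  apply Units.ext
  rw [← pow_one hilbertB, ← pow_mul, Units.val_mul, Units.val_mul, hilbertP_val,
    hilbertB_pow_val, hilbertB_pow_val]
  ext i j
  fin_cases i <;> fin_cases j <;> simp [Matrix.mul_apply, Fin.sum_univ_three] <;> grind

/-- This and the next three relations remove one `A` from a word containing two. Since `P` moves to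
the left past `A` and `B`, at most `2 * 2 * 5 * (1 + 5) = 120` normal forms remain. -/
theorem hilbertABA :
    hilbertA * (hilbertB * hilbertA) = -(hilbertB ^ 4 * (hilbertA * hilbertB ^ 4)) := by
  have h := zeta_sum
  have h5 := zeta_pow
  apply Units.ext
  simp only [Units.val_mul, Units.val_neg, hilbertB_pow_val]
  rw [hilbertA_val, hilbertM_eq, invSqrtFive, hilbertB]
  ext i j
  fin_cases i <;> fin_cases j <;> simp [Matrix.mul_apply, Fin.sum_univ_three] <;> grind

theorem hilbertAB2A : hilbertA * (hilbertB ^ 2 * hilbertA) =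
    hilbertP * (hilbertB ^ 3 * (hilbertA * hilbertB ^ 2)) := by
  have h := zeta_sum
  have h5 := zeta_pow
  apply Units.ext
  simp only [Units.val_mul, hilbertB_pow_val]
  rw [hilbertA_val, hilbertM_eq, invSqrtFive, hilbertP_val]
  ext i j
  fin_cases i <;> fin_cases j <;> simp [Matrix.mul_apply, Fin.sum_univ_three] <;> grind

theorem hilbertAB3A : hilbertA * (hilbertB ^ 3 * hilbertA) =
    hilbertP * (hilbertB ^ 2 * (hilbertA * hilbertB ^ 3)) := by
  have h := zeta_sum
  have h5 := zeta_pow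
  apply Units.ext
  simp only [Units.val_mul, hilbertB_pow_val]
  rw [hilbertA_val, hilbertM_eq, invSqrtFive, hilbertP_val]
  ext i j
  fin_cases i <;> fin_cases j <;> simp [Matrix.mul_apply, Fin.sum_univ_three] <;> grind

theorem hilbertAB4A :
    hilbertA * (hilbertB ^ 4 * hilbertA) = -(hilbertB * (hilbertA * hilbertB)) := by
  have h := zeta_sum
  have h5 := zeta_pow
  apply Units.ext
  simp only [Units.val_mul, Units.val_neg, hilbertB_pow_val]
  rw [hilbertA_val, hilbertM_eq, invSqrtFive, hilbertB]
  ext i j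
  fin_cases i <;> fin_cases j <;> simp [Matrix.mul_apply, Fin.sum_univ_three] <;> grind

theorem hilbertB_pow_mul_P (j : ℕ) : hilbertB ^ j * hilbertP = hilbertP * hilbertB ^ (4 * j) := by
  have h : SemiconjBy hilbertP (hilbertB ^ 4) hilbertB := hilbertB_mul_P.symm
  rw [pow_mul]
  exact (h.pow_right j).symm

/-- The element `± P ^ t * B ^ j` or `± P ^ t * B ^ j * A * B ^ l` of the Hilbert modular group. -/
def hilbertElt (x : Fin 2 × Fin 2 × Fin 5 × Option (Fin 5)) :
    Matrix.GeneralLinearGroup (Fin 3) ℂ :=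
  (-1) ^ x.1.val * (hilbertP ^ x.2.1.val *
    (hilbertB ^ x.2.2.1.val * x.2.2.2.elim 1 fun l => hilbertA * hilbertB ^ l.val))

theorem hilbertElt_range_none (s t j : ℕ) :
    (-1) ^ s * (hilbertP ^ t * hilbertB ^ j) ∈ Set.range hilbertElt :=
  ⟨(⟨s % 2, Nat.mod_lt _ (by norm_num)⟩, ⟨t % 2, Nat.mod_lt _ (by norm_num)⟩,
    ⟨j % 5, Nat.mod_lt _ (by norm_num)⟩, none), by
    simp only [hilbertElt, Option.elim_none, mul_one]
    rw [← pow_eq_pow_mod s (neg_one_sq), ← pow_eq_pow_mod j hilbertB_pow_five,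
      ← pow_eq_pow_mod t ((pow_two _).trans hilbertP_mul_self)]⟩

theorem hilbertElt_range_some (s t j l : ℕ) :
    (-1) ^ s * (hilbertP ^ t * (hilbertB ^ j * (hilbertA * hilbertB ^ l))) ∈
      Set.range hilbertElt :=
  ⟨(⟨s % 2, Nat.mod_lt _ (by norm_num)⟩, ⟨t % 2, Nat.mod_lt _ (by norm_num)⟩,
    ⟨j % 5, Nat.mod_lt _ (by norm_num)⟩, some ⟨l % 5, Nat.mod_lt _ (by norm_num)⟩), by
    simp only [hilbertElt, Option.elim_some]
    rw [← pow_eq_pow_mod s (neg_one_sq), ← pow_eq_pow_mod j hilbertB_pow_five,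
      ← pow_eq_pow_mod l hilbertB_pow_five,
      ← pow_eq_pow_mod t ((pow_two _).trans hilbertP_mul_self)]⟩

theorem hilbertElt_neg {σ} (hσ : σ ∈ Set.range hilbertElt) : -σ ∈ Set.range hilbertElt := by
  obtain ⟨⟨s, t, j, _ | l⟩, rfl⟩ := hσ
  · convert hilbertElt_range_none (s + 1) t j using 1
    simp [hilbertElt, pow_succ]
  · convert hilbertElt_range_some (s + 1) t j l using 1
    simp [hilbertElt, pow_succ]

theorem hilbertElt_mul_B {σ} (hσ : σ ∈ Set.range hilbertElt) :
    σ * hilbertB ∈ Set.range hilbertElt := by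
  obtain ⟨⟨s, t, j, _ | l⟩, rfl⟩ := hσ
  · convert hilbertElt_range_none s t (j + 1) using 1
    simp [hilbertElt, pow_succ, mul_assoc]
  · convert hilbertElt_range_some s t j (l + 1) using 1
    simp [hilbertElt, pow_succ, mul_assoc]

theorem hilbertElt_mul_P {σ} (hσ : σ ∈ Set.range hilbertElt) :
    σ * hilbertP ∈ Set.range hilbertElt := by
  obtain ⟨⟨s, t, j, _ | l⟩, rfl⟩ := hσ
  · convert hilbertElt_range_none s (t + 1) (4 * j) using 1
    simp only [hilbertElt, Option.elim_none, mul_one, mul_assoc, hilbertB_pow_mul_P, pow_succ]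
  · convert hilbertElt_range_some s (t + 1) (4 * j) (4 * l) using 1
    simp only [hilbertElt, Option.elim_some, mul_assoc, hilbertB_pow_mul_P, pow_succ]
    rw [← mul_assoc hilbertA, hilbertA_mul_P, mul_assoc, ← mul_assoc _ hilbertP,
      hilbertB_pow_mul_P, mul_assoc]

theorem hilbertElt_mul_A {σ} (hσ : σ ∈ Set.range hilbertElt) :
    σ * hilbertA ∈ Set.range hilbertElt := by
  obtain ⟨⟨s, t, j, _ | l⟩, rfl⟩ := hσ
  · convert hilbertElt_range_some s t j 0 using 1
    simp [hilbertElt, mul_assoc]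
  · have hP : ∀ X, hilbertB ^ j.val * (hilbertP * X) = hilbertP * (hilbertB ^ (4 * j.val) * X) := by
      intro X
      rw [← mul_assoc, hilbertB_pow_mul_P, mul_assoc]
    fin_cases l
    · convert hilbertElt_range_none s t j using 1
      simp [hilbertElt, mul_assoc, hilbertA_mul_self]
    · convert hilbertElt_range_some (s + 1) t (j + 4) 4 using 1
      simp [hilbertElt, mul_assoc, hilbertABA, pow_add]
    · convert hilbertElt_range_some s (t + 1) (4 * j + 3) 2 using 1
      simp [hilbertElt, mul_assoc, hilbertAB2A, pow_add, hP]
    · convert hilbertElt_range_some s (t + 1) (4 * j + 2) 3 using 1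
      simp [hilbertElt, mul_assoc, hilbertAB3A, pow_add, hP]
    · convert hilbertElt_range_some (s + 1) t (j + 1) 1 using 1
      simp [hilbertElt, mul_assoc, hilbertAB4A, pow_add]

theorem hilbertA_mem : hilbertA ∈ hilbertGroup := Subgroup.subset_closure (by simp)

theorem hilbertB_mem : hilbertB ∈ hilbertGroup := Subgroup.subset_closure (by simp)

theorem hilbertC_mem : hilbertC ∈ hilbertGroup := Subgroup.subset_closure (by simp)

/-- The scalar `-1` is not a generator but arises from `hilbertABA`; it is what brings `P = -C` into
the group. -/
theorem neg_one_mem_hilbertGroup : -1 ∈ hilbertGroup := by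
  have h : hilbertA * (hilbertB * hilbertA) * (hilbertB * hilbertA * hilbertB) = -1 := by
    rw [hilbertABA]
    have h4 : hilbertB ^ 4 * hilbertB = 1 := by rw [← pow_succ, hilbertB_pow_five]
    calc _ = -(hilbertB ^ 4 * (hilbertA * (hilbertB ^ 4 * hilbertB * hilbertA) * hilbertB)) := by
          simp only [neg_mul, mul_assoc]
      _ = -1 := by rw [h4, one_mul, hilbertA_mul_self, one_mul, h4]
  rw [← h]
  exact mul_mem (mul_mem hilbertA_mem (mul_mem hilbertB_mem hilbertA_mem))
    (mul_mem (mul_mem hilbertB_mem hilbertA_mem) hilbertB_mem)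

theorem hilbertP_mem : hilbertP ∈ hilbertGroup := by
  rw [hilbertP, ← neg_one_mul]
  exact mul_mem neg_one_mem_hilbertGroup hilbertC_mem

theorem hilbertElt_mem (x) : hilbertElt x ∈ hilbertGroup := by
  obtain ⟨s, t, j, o⟩ := x
  refine mul_mem (pow_mem neg_one_mem_hilbertGroup _) (mul_mem (pow_mem hilbertP_mem _)
    (mul_mem (pow_mem hilbertB_mem _) ?_))
  rcases o with _ | l
  · exact one_mem _
  · exact mul_mem hilbertA_mem (pow_mem hilbertB_mem _)

theorem mem_range_hilbertElt {σ} (hσ : σ ∈ hilbertGroup) : σ ∈ Set.range hilbertElt := by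
  have hC : hilbertC = -hilbertP := (neg_neg _).symm
  induction hσ using Subgroup.closure_induction_right with
  | one => simpa using hilbertElt_range_none 0 0 0
  | mul_right x _ y hy ih =>
    rcases hy with rfl | rfl | rfl
    · exact hilbertElt_mul_A ih
    · exact hilbertElt_mul_B ih
    · rw [hC, mul_neg]
      exact hilbertElt_neg (hilbertElt_mul_P ih)
  | mul_inv_cancel x _ y hy ih =>
    rcases hy with rfl | rfl | rfl
    · rw [inv_eq_of_mul_eq_one_right hilbertA_mul_self]
      exact hilbertElt_mul_A ih
    · rw [inv_eq_of_mul_eq_one_right (b := hilbertB * hilbertB * hilbertB * hilbertB)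
        (by rw [← hilbertB_pow_five]; simp only [pow_succ, pow_zero, one_mul, mul_assoc])]
      simp only [← mul_assoc]
      exact hilbertElt_mul_B (hilbertElt_mul_B (hilbertElt_mul_B (hilbertElt_mul_B ih)))
    · rw [inv_eq_of_mul_eq_one_right (b := hilbertC)
        (by rw [hC, neg_mul_neg, hilbertP_mul_self]), hC, mul_neg]
      exact hilbertElt_neg (hilbertElt_mul_P ih)

/-- The first rows of the elements of the Hilbert modular group, up to sign. -/
def hilbertRow (o : Option (Fin 5)) : Fin 3 → ℂ :=
  o.elim ![1, 0, 0] fun l =>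
    ![invSqrtFive, 2 * invSqrtFive * (zeta ^ 2) ^ l.val, 2 * invSqrtFive * (zeta ^ 3) ^ l.val]

/-- Neither `P` nor a power of `B` on the left changes the first row. -/
theorem hilbertElt_row (x) :
    (hilbertElt x).val 0 = (-1 : ℂ) ^ x.1.val • hilbertRow x.2.2.2 := by
  obtain ⟨s, t, j, o⟩ := x
  have hs : ((-1 : Matrix.GeneralLinearGroup (Fin 3) ℂ) ^ s.val).val =
      (-1 : ℂ) ^ s.val • (1 : Matrix (Fin 3) (Fin 3) ℂ) := by
    fin_cases s <;> simp
  have ht : ∀ M : Matrix (Fin 3) (Fin 3) ℂ, ((hilbertP ^ t.val).val * M) 0 = M 0 := by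
    intro M
    ext i
    fin_cases t <;> simp [hilbertP_val, Matrix.mul_apply, Fin.sum_univ_three]
  have hj : ∀ M : Matrix (Fin 3) (Fin 3) ℂ, ((hilbertB ^ j.val).val * M) 0 = M 0 := by
    intro M
    ext i
    rw [hilbertB_pow_val]
    simp [Matrix.mul_apply, Fin.sum_univ_three]
  have ho : (o.elim 1 fun l => hilbertA * hilbertB ^ l.val :
      Matrix.GeneralLinearGroup (Fin 3) ℂ).val 0 = hilbertRow o := by
    rcases o with _ | l
    · ext i
      fin_cases i <;> simp [hilbertRow]
    · rw [Option.elim_some, Units.val_mul, hilbertB_pow_val, hilbertA_val, hilbertM_eq]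
      ext i
      fin_cases i <;> simp [hilbertRow, Matrix.mul_apply, Fin.sum_univ_three]
  rw [hilbertElt, Units.val_mul, hs, smul_mul_assoc, one_mul, Units.val_mul, Units.val_mul]
  ext i
  rw [Matrix.smul_apply, ht, hj, ho]
  rfl

theorem isPrimitiveRoot_zeta_sq : IsPrimitiveRoot (zeta ^ 2) 5 :=
  isPrimitiveRoot_zeta.pow_of_coprime 2 (by norm_num)

theorem hilbertElt_injective : Function.Injective hilbertElt := by
  rintro ⟨s, t, j, o⟩ ⟨s', t', j', o'⟩ h
  have hc := invSqrtFive_sq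
  have hc0 := invSqrtFive_ne_zero
  have hrow := congrArg (fun σ => σ.val 0) h
  simp only [hilbertElt_row] at hrow
  have r0 := congrFun hrow 0
  have r1 := congrFun hrow 1
  have e := neg_one_pow_mul_self s.val
  have e' := neg_one_pow_mul_self s'.val
  -- The square of the first entry, `1` or `1/5`, tells whether `A` occurs, independently of the
  -- sign.
  obtain ⟨rfl, rfl⟩ : s = s' ∧ o = o' := by
    rcases o with _ | l <;> rcases o' with _ | l' <;>
      simp only [hilbertRow, Option.elim_none, Option.elim_some, Pi.smul_apply, smul_eq_mul,
        Matrix.cons_val_zero, Matrix.cons_val_one, mul_one] at r0 r1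
    · exact ⟨neg_one_pow_fin_two_injective r0, rfl⟩
    · exfalso
      rw [r0] at e
      have : (1 : ℂ) / 5 = 1 := by linear_combination e - invSqrtFive ^ 2 * e' - hc
      norm_num at this
    · exfalso
      rw [← r0] at e'
      have : (1 : ℂ) / 5 = 1 := by linear_combination e' - invSqrtFive ^ 2 * e - hc
      norm_num at this
    · have hss : (-1 : ℂ) ^ s.val = (-1) ^ s'.val := mul_right_cancel₀ hc0 r0
      rw [hss] at r1
      have hl := mul_left_cancel₀ (mul_ne_zero two_ne_zero hc0)
        (mul_left_cancel₀ (pow_ne_zero _ (by norm_num)) r1)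
      exact ⟨neg_one_pow_fin_two_injective hss,
        congrArg some (Fin.ext (isPrimitiveRoot_zeta_sq.pow_inj l.2 l'.2 hl))⟩
  have hB : hilbertP ^ t.val * hilbertB ^ j.val = hilbertP ^ t'.val * hilbertB ^ j'.val := by
    simp only [hilbertElt, ← mul_assoc] at h
    simp only [mul_assoc] at h
    have := mul_left_cancel h
    simp only [← mul_assoc] at this
    exact mul_right_cancel this
  have h0 : ∀ k : ℕ, (zeta ^ 2) ^ k ≠ 0 := fun k =>
    pow_ne_zero k (isPrimitiveRoot_zeta_sq.ne_zero (by norm_num))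
  -- In the middle column of `P ^ t * B ^ j` the position of the nonzero entry gives `t` and its
  -- value gives `j`.
  have hj := congrArg (fun σ => (σ.val 1 1, σ.val 2 1)) hB
  simp only [Units.val_mul, hilbertB_pow_val] at hj
  fin_cases t <;> fin_cases t' <;>
    simp [hilbertP_val, Matrix.mul_apply, Fin.sum_univ_three, h0, (h0 _).symm] at hj ⊢
  · exact Fin.ext (isPrimitiveRoot_zeta_sq.pow_inj j.2 j'.2 hj)
  · exact Fin.ext (isPrimitiveRoot_zeta_sq.pow_inj j.2 j'.2 hj)

/-- The parametrization of the Hilbert modular group by `hilbertElt`. -/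
def hilbertEquiv : (Fin 2 × Fin 2 × Fin 5 × Option (Fin 5)) ≃ hilbertGroup :=
  Equiv.ofBijective (fun x => ⟨hilbertElt x, hilbertElt_mem x⟩)
    ⟨fun _ _ h => hilbertElt_injective (congrArg Subtype.val h), fun σ => by
      obtain ⟨x, hx⟩ := mem_range_hilbertElt σ.2
      exact ⟨x, Subtype.ext hx⟩⟩

theorem card_hilbertGroup : Nat.card hilbertGroup = 120 := by
  rw [← Nat.card_congr hilbertEquiv]
  simp

instance : Finite hilbertGroup := Finite.of_equiv _ hilbertEquiv

/-! ### E-polynomials of the Hilbert modular group and their Jacobian -/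

theorem ePoly_hilbertGroup {k : ℕ} (hk : Even k) :
    ePoly hilbertGroup k = C (1 / 6) * ∑ o, vecForm (hilbertRow o) ^ k := by
  rw [ePoly, ← finsum_comp_equiv hilbertEquiv, finsum_eq_sum_of_fintype, card_hilbertGroup]
  have h : ∀ x, linForm (hilbertEquiv x).1.val 0 ^ k = vecForm (hilbertRow x.2.2.2) ^ k := by
    intro x
    have : linForm (hilbertEquiv x).1.val 0 = vecForm ((hilbertElt x).val 0) := rfl
    rw [this, hilbertElt_row, vecForm_smul, mul_pow, ← map_pow, ← pow_mul, mul_comm x.1.val,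
      pow_mul, hk.neg_one_pow, one_pow, map_one, one_mul]
  simp_rw [h, Fintype.sum_prod_type]
  -- Each row occurs `2 * 2 * 5 = 20` times up to sign, and `20 / 120 = 1 / 6`.
  simp only [Finset.sum_const, Finset.card_univ, Fintype.card_fin, ← mul_smul]
  rw [nsmul_eq_mul, ← mul_assoc, ← map_natCast (C (R := ℂ)), ← map_mul]
  norm_num

theorem eval_pderiv_ePoly_hilbertGroup {k : ℕ} (hk : Even k) (p : Fin 3 → ℂ) (j : Fin 3) :
    eval p (pderiv j (ePoly hilbertGroup k)) =
      k / 6 * ∑ o, (∑ i, hilbertRow o i * p i) ^ (k - 1) * hilbertRow o j := by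
  rw [ePoly_hilbertGroup hk, pderiv_C_mul, map_mul, eval_C, map_sum, map_sum]
  simp_rw [eval_pderiv_vecForm_pow, mul_assoc, ← Finset.mul_sum]
  ring

theorem jacobian_hilbertGroup_ne_zero :
    jacobian (fun i => ePoly hilbertGroup (![2, 6, 10] i)) ≠ 0 := by
  intro h
  have h := congrArg (eval ![0, 1, 0]) h
  rw [jacobian, RingHom.map_det, Matrix.det_fin_three, map_zero] at h
  have e2 : Even 2 := by decide
  have e6 : Even 6 := by decide
  have e10 : Even 10 := by decide
  have h1 := zeta_sum
  have h5 := zeta_pow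
  have hc := invSqrtFive_sq
  -- At `(0, 1, 0)` the derivatives in `t_0`, `t_1`, `t_2` are multiples of the sums over `l` of `ζ
  -- ^ (2 * l * (k - 1))`, `ζ ^ (2 * l * k)` and `ζ ^ (l * (2 * k + 1))`. These survive only when 5
  -- divides `k - 1`, `k`, `2 * k + 1` respectively, so each of the weights 2, 6, 10 contributes a
  -- single nonzero entry, each in a different column.
  have a2 : ∀ j : Fin 3, eval ![0, 1, 0] (pderiv j (ePoly hilbertGroup 2)) = ![0, 0, 4 / 3] j := by
    intro j
    rw [eval_pderiv_ePoly_hilbertGroup e2]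
    fin_cases j <;>
      simp [Fin.sum_univ_three, Fin.sum_univ_five, Fintype.sum_option, hilbertRow] <;> grind
  have a6 : ∀ j : Fin 3, eval ![0, 1, 0] (pderiv j (ePoly hilbertGroup 6)) = ![32 / 25, 0, 0] j := by
    intro j
    rw [eval_pderiv_ePoly_hilbertGroup e6]
    fin_cases j <;>
      simp [Fin.sum_univ_three, Fin.sum_univ_five, Fintype.sum_option, hilbertRow] <;> grind
  have a10 : ∀ j : Fin 3, eval ![0, 1, 0] (pderiv j (ePoly hilbertGroup 10)) = ![0, 1024 / 375, 0] j := by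
    intro j
    rw [eval_pderiv_ePoly_hilbertGroup e10]
    fin_cases j <;>
      simp [Fin.sum_univ_three, Fin.sum_univ_five, Fintype.sum_option, hilbertRow] <;> grind
  have key : ∀ i j : Fin 3, eval ![0, 1, 0] (pderiv j (ePoly hilbertGroup (![2, 6, 10] i))) =
      !![0, 0, 4 / 3; 32 / 25, 0, 0; 0, 1024 / 375, 0] i j := by
    intro i j
    fin_cases i
    exacts [a2 j, a6 j, a10 j]
  simp only [RingHom.mapMatrix_apply, Matrix.map_apply, Matrix.of_apply, key] at h
  simp at h

/-! ### Mirrors of the Hilbert modular group -/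

/-- Linear forms that define the mirrors of the Hilbert modular group. -/
def hilbertMirror (x : Fin 3 × Fin 5) : Fin 3 → ℂ :=
  Matrix.vecMul (![![0, 1, -1], ![1, zeta ^ 2 + zeta ^ 3, zeta ^ 2 + zeta ^ 3],
    ![1, zeta + zeta ^ 4, zeta + zeta ^ 4]] x.1) (hilbertB ^ x.2.val).val

/-- The three base forms belong to the order-2 reflections `P`, `A` and `-P * A`; translation by
powers of `B` gives the 15 mirrors. -/
theorem hilbertMirror_dvd {h : Fin 3 → MvPolynomial (Fin 3) ℂ}
    (hh : ∀ i, h i ∈ invRing hilbertGroup) (x) : vecForm (hilbertMirror x) ∣ jacobian h := by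
  have hrefl : ∀ (σ : Matrix.GeneralLinearGroup (Fin 3) ℂ) (u v : Fin 3 → ℂ), σ ∈ hilbertGroup →
      v ≠ 0 → σ.val = 1 + Matrix.vecMulVec u v → Matrix.vecMul v σ.val = (-1 : ℂ) • v →
      σ.val.det = -1 → vecForm v ^ 1 ∣ jacobian h := by
    intro σ u v hσ hv hu hv' hdet
    refine vecForm_pow_dvd hv u hu hv' ?_ ?_
    · rw [← hdet]
      exact (jacobian_subst _ h fun i => hh i _ hσ).symm
    · simp only [Finset.Icc_self, Finset.mem_singleton, forall_eq]
      norm_num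
  have h1 := zeta_sum
  have h5 := zeta_pow
  obtain ⟨i, m⟩ := x
  rw [← pow_one (vecForm _)]
  refine vecForm_pow_dvd_of_orbit hh ?_ (pow_mem hilbertB_mem _)
  fin_cases i
  · refine hrefl hilbertP ![0, -1, 1] ![0, 1, -1] hilbertP_mem ?_ ?_ ?_ ?_
    · exact fun h => by simpa using congrFun h 1
    · ext i j
      rw [Matrix.add_apply, Matrix.vecMulVec_apply, hilbertP_val]
      fin_cases i <;> fin_cases j <;> simp
    · rw [hilbertP_val]
      ext i
      fin_cases i <;> simp [Matrix.vecMul, dotProduct, Fin.sum_univ_three]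
    · rw [hilbertP_val]
      simp [Matrix.det_fin_three]
  -- As the mirror form has leading entry 1, the vector `u` is the first column of `A - 1`; the same
  -- rule gives `u` for `-P * A`.
  · refine hrefl hilbertA ![invSqrtFive - 1, invSqrtFive, invSqrtFive]
      ![1, zeta ^ 2 + zeta ^ 3, zeta ^ 2 + zeta ^ 3] hilbertA_mem ?_ ?_ ?_ ?_
    · exact fun h => by simpa using congrFun h 0
    · ext i j
      rw [Matrix.add_apply, Matrix.vecMulVec_apply, hilbertA_val, hilbertM_eq, invSqrtFive]
      fin_cases i <;> fin_cases j <;> simp <;> grind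
    · rw [hilbertA_val, hilbertM_eq, invSqrtFive]
      ext i
      fin_cases i <;> simp [Matrix.vecMul, dotProduct, Fin.sum_univ_three] <;> grind
    · rw [hilbertA_val, hilbertM_eq, invSqrtFive]
      simp [Matrix.det_fin_three]
      grind
  · have hval : (hilbertP * -hilbertA).val = -!![invSqrtFive, 2 * invSqrtFive, 2 * invSqrtFive;
        invSqrtFive, invSqrtFive * (zeta ^ 2 + zeta ^ 3), invSqrtFive * (zeta + zeta ^ 4);
        invSqrtFive, invSqrtFive * (zeta + zeta ^ 4), invSqrtFive * (zeta ^ 2 + zeta ^ 3)] := by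
      rw [Units.val_mul, Units.val_neg, hilbertP_val, hilbertA_val, hilbertM_eq]
      ext i j
      fin_cases i <;> fin_cases j <;> simp [Matrix.mul_apply, Fin.sum_univ_three]
    refine hrefl (hilbertP * -hilbertA) ![-invSqrtFive - 1, -invSqrtFive, -invSqrtFive]
      ![1, zeta + zeta ^ 4, zeta + zeta ^ 4] (mul_mem hilbertP_mem ?_) ?_ ?_ ?_ ?_
    · rw [← neg_one_mul]
      exact mul_mem neg_one_mem_hilbertGroup hilbertA_mem
    · exact fun h => by simpa using congrFun h 0
    · ext i j
      rw [Matrix.add_apply, Matrix.vecMulVec_apply, hval, invSqrtFive]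
      fin_cases i <;> fin_cases j <;> simp <;> grind
    · rw [hval, invSqrtFive]
      ext i
      fin_cases i <;> simp [Matrix.vecMul, dotProduct, Fin.sum_univ_three] <;> grind
    · rw [hval, invSqrtFive]
      simp [Matrix.det_fin_three]
      grind

theorem hilbertMirror_zero (m : Fin 5) :
    hilbertMirror (0, m) = ![0, (zeta ^ 2) ^ m.val, -(zeta ^ 3) ^ m.val] := by
  rw [hilbertMirror, hilbertB_pow_val]
  ext i
  fin_cases i <;> simp [Matrix.vecMul, dotProduct, Fin.sum_univ_three]

theorem hilbertMirror_one (m : Fin 5) : hilbertMirror (1, m) =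
    ![1, (zeta ^ 2 + zeta ^ 3) * (zeta ^ 2) ^ m.val,
      (zeta ^ 2 + zeta ^ 3) * (zeta ^ 3) ^ m.val] := by
  rw [hilbertMirror, hilbertB_pow_val]
  ext i
  fin_cases i <;> simp [Matrix.vecMul, dotProduct, Fin.sum_univ_three]

theorem hilbertMirror_two (m : Fin 5) : hilbertMirror (2, m) =
    ![1, (zeta + zeta ^ 4) * (zeta ^ 2) ^ m.val, (zeta + zeta ^ 4) * (zeta ^ 3) ^ m.val] := by
  rw [hilbertMirror, hilbertB_pow_val]
  ext i
  fin_cases i <;> simp [Matrix.vecMul, dotProduct, Fin.sum_univ_three]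

theorem zeta_sq_pow_mul (m : ℕ) : (zeta ^ 2) ^ m * (zeta ^ 3) ^ m = 1 := by
  rw [← mul_pow, ← pow_add, zeta_pow, one_pow]

theorem hilbertMirror_ne_zero (x) : hilbertMirror x ≠ 0 := by
  intro h
  obtain ⟨i, m⟩ := x
  have hm := zeta_sq_pow_mul m
  fin_cases i
  · have := congrFun ((hilbertMirror_zero m).symm.trans h) 1
    simp only [Matrix.cons_val_one, Matrix.cons_val_zero, Pi.zero_apply] at this
    simp [this] at hm
  · simpa using congrFun ((hilbertMirror_one m).symm.trans h) 0
  · simpa using congrFun ((hilbertMirror_two m).symm.trans h) 0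

/-- Types with vanishing and nonvanishing first entry cannot be proportional. Between the last two
types, `c = 1` would give `(ζ + ζ⁴)² = (ζ² + ζ³)²`, which is false. Within the first type `c² = 1`,
and `c = -1` contradicts equality of fifth powers; otherwise `c = 1` and the exponents agree. -/
theorem hilbertMirror_ne_smul (x y) (hxy : x ≠ y) (c : ℂ) :
    hilbertMirror y ≠ c • hilbertMirror x := by
  have h1 := zeta_sum
  obtain ⟨i, m⟩ := x
  obtain ⟨i', m'⟩ := y
  have hm := zeta_sq_pow_mul m
  have hm' := zeta_sq_pow_mul m'
  have hinj : (zeta ^ 2) ^ m.val = (zeta ^ 2) ^ m'.val → m = m' := fun h =>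
    Fin.ext (isPrimitiveRoot_zeta_sq.pow_inj m.2 m'.2 h)
  have ha : zeta + zeta ^ 4 ≠ 0 := by grind
  have hb : zeta ^ 2 + zeta ^ 3 ≠ 0 := by grind
  have h5 : ∀ k : ℕ, ((zeta ^ 2) ^ k) ^ 5 = 1 := fun k => by
    rw [pow_right_comm, isPrimitiveRoot_zeta_sq.pow_eq_one, one_pow]
  have hp := h5 m
  have hp' := h5 m'
  have v0 := hilbertMirror_zero m
  have v1 := hilbertMirror_one m
  have v2 := hilbertMirror_two m
  have v0' := hilbertMirror_zero m'
  have v1' := hilbertMirror_one m'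
  have v2' := hilbertMirror_two m'
  -- From here the powers enter only through `p * q = 1`, `p ^ 5 = 1` and the injectivity of `m ↦
  -- p`.
  generalize (zeta ^ 2) ^ m.val = p at *
  generalize (zeta ^ 3) ^ m.val = q at *
  generalize (zeta ^ 2) ^ m'.val = p' at *
  generalize (zeta ^ 3) ^ m'.val = q' at *
  intro h
  have e0 := congrFun h 0
  have e1 := congrFun h 1
  have e2 := congrFun h 2
  fin_cases i <;> fin_cases i' <;>
    simp only [Fin.reduceFinMk, Fin.zero_eta, Fin.mk_one, v0, v1, v2, v0', v1', v2', Pi.smul_apply,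
      smul_eq_mul, Matrix.cons_val] at e0 e1 e2
  · have : p = p' := by grind
    exact hxy (by rw [hinj this])
  · grind
  · grind
  · grind
  · have : p = p' := by grind
    exact hxy (by rw [hinj this])
  · grind
  · grind
  · grind
  · have : p = p' := by grind
    exact hxy (by rw [hinj this])

theorem eRing_hilbertGroup :
    MinimallyGeneratedByWeights hilbertGroup {2, 6, 10} ∧
      eRing hilbertGroup = invRing hilbertGroup ∧
      hilbertSeries (eRing hilbertGroup) =
        ((1 - PowerSeries.X ^ 2) * (1 - PowerSeries.X ^ 6) * (1 - PowerSeries.X ^ 10))⁻¹ := by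
  -- The degree count is `1 + 5 + 9 = 15 * 1`.
  have := eRing_properties (G := hilbertGroup) (w := ![2, 6, 10])
    (by intro i; fin_cases i <;> simp) jacobian_hilbertGroup_ne_zero hilbertMirror 1
    hilbertMirror_ne_zero hilbertMirror_ne_smul
    (fun _ hh x => by rw [pow_one]; exact hilbertMirror_dvd hh x) (by simp [Fin.sum_univ_three])
  rwa [Fin.prod_univ_three, Matrix.range_cons, Matrix.range_cons, Matrix.range_cons,
    Matrix.range_empty, Set.union_empty] at this

end

end EPoly

theorem mainTheorem6 :
    -- the group attached to ternary self-dual codes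
    (Nat.card EPoly.ternaryGroup = 24 ∧
      EPoly.MinimallyGeneratedByWeights EPoly.ternaryGroup {4, 6} ∧
      (∀ k : ℕ, 4 ≤ k → Even k →
        EPoly.degPart (EPoly.eRing EPoly.ternaryGroup) k =
            EPoly.degPart (EPoly.invRing EPoly.ternaryGroup) k ∧
          Module.finrank ℂ (EPoly.degPart (EPoly.eRing EPoly.ternaryGroup) k) =
            Module.finrank ℂ (EPoly.degPart (EPoly.invRing EPoly.ternaryGroup) k)) ∧
      EPoly.hilbertSeries (EPoly.eRing EPoly.ternaryGroup) =
        ((1 - PowerSeries.X ^ 4) * (1 - PowerSeries.X ^ 6))⁻¹) ∧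
    -- the group attached to symmetric Hilbert modular forms
    (Nat.card EPoly.hilbertGroup = 120 ∧
      EPoly.MinimallyGeneratedByWeights EPoly.hilbertGroup {2, 6, 10} ∧
      (∀ k : ℕ, Even k →
        EPoly.degPart (EPoly.eRing EPoly.hilbertGroup) k =
            EPoly.degPart (EPoly.invRing EPoly.hilbertGroup) k ∧
          Module.finrank ℂ (EPoly.degPart (EPoly.eRing EPoly.hilbertGroup) k) =
            Module.finrank ℂ (EPoly.degPart (EPoly.invRing EPoly.hilbertGroup) k)) ∧
      EPoly.hilbertSeries (EPoly.eRing EPoly.hilbertGroup) =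
        ((1 - PowerSeries.X ^ 2) * (1 - PowerSeries.X ^ 6) * (1 - PowerSeries.X ^ 10))⁻¹) := by
  obtain ⟨h1, h2, h3⟩ := EPoly.eRing_ternaryGroup
  obtain ⟨h1', h2', h3'⟩ := EPoly.eRing_hilbertGroup
  exact ⟨⟨EPoly.card_ternaryGroup, h1, fun k _ _ => by rw [h2]; exact ⟨rfl, rfl⟩, h3⟩,
    ⟨EPoly.card_hilbertGroup, h1', fun k _ => by rw [h2']; exact ⟨rfl, rfl⟩, h3'⟩⟩
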